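/- **Setting.** Let $F=(f_1,\dots,f_n)$, $n\ge 1$, be a square system of polynomials in $\mathbb Z[x_1,\dots,x_n]$ of total degree at most $d$, with coefficients of at most $\tau$ bits and at most $m$ terms each ($d,\tau,m\ge 1$), and let $0<\rho<1$ be a rational number. Boxes are products of closed intervals with rational endpoints, $m(B)$ is the middle point and $w(B)$ the largest side length of $B$, $J_F$ is the Jacobian matrix, and $\Box$ denotes termwise evaluation in interval arithmetic. A (rational or interval) $n\times n$ matrix is an *S-M matrix* if, for $1\le i\le n$, the determinants of all submatrices of order $i$ of its first $i$ rows do not contain $0$. Let $V$ be a rational S-M matrix whose entries have bit size at most $\beta n$, and let $r\ge 0$ be an integer (a bound for the number of refinements). **Algorithm.** Start with the set of pending boxes $\{[-1,1]^n\}$ and with empty sets $R$ (isolating boxes) and $SR$ (suspected root boxes). While there is a pending box, take one, $B$, out of the set. 1. If $0\notin\Box f_i(B)$ for some $i$, throw $B$ away. 2. Otherwise, if $J_F(m(B))$ is invertible, put $W=VJ_F(m(B))^{-1}$ and $G=WF=(g_1,\dots,g_n)$, and test whether the interval matrix $W\cdot\Box J_F(B)$ is an S-M matrix. If it is, apply the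 existence test below to $(G,B)$: put $B$ into $R$ if the answer is $1$, throw it away if the answer is $0$, and put it into $SR$ if the answer is *Unknown*. 3. In the remaining cases, bisect a widest side of $B$ and make the two halves pending if $w(B)>\rho$; otherwise put $B$ into $SR$. *Existence test* for $(g_1,\dots,g_k)$ on a $k$-dimensional box. For $k=0$ the answer is $1$. For $k\ge1$, apply the test for $(g_1,\dots,g_{k-1})$ to the $2k$ facets one after the other, until two answers are $1$. If an answer *Unknown* occurs, answer *Unknown*; if no facet has answer $1$, answer $0$; if exactly one has, answer *Unknown*. Otherwise let $B_1,B_2$ be the two facets found. For each of them determine the sign of $g_k$ on its vertices ($\pm1$ if constant, else $0$). As long as this sign is $0$ and the facet is wider than $\rho$, at most $r$ times, bisect a widest side and replace the facet by a half on which the test for $(g_1,\dots,g_{k-1})$ answers $1$, stopping if there is none. Answer $1$, $0$ or *Unknown* according to whether the product of the two final signs is negative, positive or zero. Determinants are computed by Laplace expansion, inverses by Cramer's rule, powers by repeated squaring. **Cost.** The bit size of a rational number is the sum of the binary lengths of numerator and denominator. One arithmetic operation or comparison on rational numbers of total bit size $s$ is charged $M(s)$ bit operations (the test whether a length, which is a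 power of two, exceeds the fixed number $\rho$ is charged $M$ of the bit size of that length), and each iteration of the main loop one more. Here $M:\mathbb N\to\mathbb N$ is any function with $M(s)\ge s$, $M(s)+M(t)\le M(s+t)$ and $M(cs)\le c^2M(s)$ for all $s,t,c\in\mathbb N$. The computation of the partial derivatives of $F$ is included. **Theorem.** For all $r$, $\beta$ and $\rho_0<1$ there is a constant $C>0$, depending on nothing else, such that for all data as above with $\rho\le\rho_0$ the algorithm, whichever pending box is taken in each iteration, terminates, and uses at most $$C\left(\frac8\rho\right)^{n}n^{n+1}\,m\,M\bigl(\lceil -d\log_2\rho+\tau\rceil\bigr)$$ bit operations. In particular, when arithmetic operations are charged linearly, $M(s)=s$, isolating the real roots of $F$ in $[-1,1]^n$ with termination precision $\rho$ costs $O\bigl((8/\rho)^n n^{n+1}m(-d\log\rho+\tau)\bigr)$ bit operations. -/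

import Mathlib

namespace RootIsolation

/-! ### Computations with a bit count -/

/-- The result of a computation together with the number of bit operations it has used. -/
structure Timed (α : Type) where
  val : α
  time : ℕ

instance : Monad Timed where
  pure a := ⟨a, 0⟩
  bind x f := ⟨(f x.val).val, x.time + (f x.val).time⟩

/-- Compute all `f i`, one after the other, and store the results. -/
def tabulate {n : ℕ} {α : Type} (f : Fin n → Timed α) : Timed (Fin n → α) :=
  ⟨fun i => (f i).val, ∑ i, (f i).time⟩

/-- The bit size of a rational number: binary length of numerator plus that of denominator. -/
def bitSize (q : ℚ) : ℕ := Nat.size q.num.natAbs + Nat.size q.den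

/-- `M s` is the number of bit operations charged for one arithmetic operation or comparison on
rational numbers of total bit size `s`. The usual regularity conditions on such a function: it
is at least linear, superadditive, and at most quadratic. The linear count is `M s = s`,
schoolbook arithmetic is `M s = s ^ 2`. -/
structure IsArithCost (M : ℕ → ℕ) : Prop where
  le_self : ∀ s, s ≤ M s
  add_le : ∀ s t, M s + M t ≤ M (s + t)
  mul_le : ∀ c s, M (c * s) ≤ c ^ 2 * M s

section Arithmetic

variable (M : ℕ → ℕ)

def qop {α : Type} (x y : ℚ) (v : α) : Timed α := ⟨v, M (bitSize x + bitSize y)⟩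

def qadd (x y : ℚ) : Timed ℚ := qop M x y (x + y)
def qsub (x y : ℚ) : Timed ℚ := qop M x y (x - y)
def qmul (x y : ℚ) : Timed ℚ := qop M x y (x * y)
def qdiv (x y : ℚ) : Timed ℚ := qop M x y (x / y)
def qmin (x y : ℚ) : Timed ℚ := qop M x y (min x y)
def qmax (x y : ℚ) : Timed ℚ := qop M x y (max x y)
def qlt (x y : ℚ) : Timed Bool := qop M x y (decide (x < y))

/-- The test whether a length `w` exceeds the precision `ρ`. All lengths that are tested are
powers of two, so only `w` has to be read (its exponent is compared with a fixed number). -/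
def exceeds (ρ w : ℚ) : Timed Bool := ⟨decide (ρ < w), M (bitSize w)⟩

/-! ### Interval arithmetic -/

/-- A closed interval with rational endpoints; a rational number is a degenerate interval. -/
structure IV where
  lo : ℚ
  hi : ℚ

def IV.pt (q : ℚ) : IV := ⟨q, q⟩

def iadd (I J : IV) : Timed IV := do
  let a ← qadd M I.lo J.lo
  let b ← qadd M I.hi J.hi
  return ⟨a, b⟩

def isub (I J : IV) : Timed IV := do
  let a ← qsub M I.lo J.hi
  let b ← qsub M I.hi J.lo
  return ⟨a, b⟩

def imul (I J : IV) : Timed IV := do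
  let p ← qmul M I.lo J.lo
  let q ← qmul M I.lo J.hi
  let r ← qmul M I.hi J.lo
  let s ← qmul M I.hi J.hi
  let a₁ ← qmin M p q
  let a₂ ← qmin M r s
  let a ← qmin M a₁ a₂
  let b₁ ← qmax M p q
  let b₂ ← qmax M r s
  let b ← qmax M b₁ b₂
  return ⟨a, b⟩

/-- `I / J`, only used when `0 ∉ J`. -/
def idiv (I J : IV) : Timed IV := do
  let a ← qdiv M 1 J.hi
  let b ← qdiv M 1 J.lo
  imul M I ⟨a, b⟩

/-- The power `I * ⋯ * I` (`e` factors), by repeated squaring. -/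
def ipow (I : IV) (e : ℕ) : Timed IV :=
  if e = 0 then pure (IV.pt 1)
  else do
    let h ← ipow I (e / 2)
    let s ← imul M h h
    if e % 2 = 0 then pure s else imul M s I
  termination_by e
  decreasing_by omega

/-- `1` if the interval is positive, `-1` if it is negative, `0` otherwise. -/
def isign (I : IV) : Timed ℤ := do
  let p ← qlt M 0 I.lo
  let q ← qlt M I.hi 0
  return if p then 1 else if q then -1 else 0

end Arithmetic

/-! ### Polynomials and their interval evaluation -/

/-- Boxes, as products of intervals. -/
abbrev Box (n : ℕ) := Fin n → IV

/-- A polynomial in sparse form: the list of its monomials with their coefficients. -/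
abbrev Terms (n : ℕ) := List ((Fin n →₀ ℕ) × ℚ)

noncomputable def termsOf {n : ℕ} (p : MvPolynomial (Fin n) ℤ) : Terms n :=
  p.support.toList.map fun e => (e, ((p.coeff e : ℤ) : ℚ))

section Algorithm

variable (M : ℕ → ℕ) {n : ℕ}

/-- `∑ j, A j * X j`. -/
def dot (A X : Fin n → IV) : Timed IV :=
  (List.finRange n).foldlM (fun acc j => do
    let t ← imul M (A j) (X j)
    iadd M acc t) (IV.pt 0)

def monoEval (t : (Fin n →₀ ℕ) × ℚ) (B : Box n) : Timed IV :=
  (List.finRange n).foldlM (fun acc j => do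
    let p ← ipow M (B j) (t.1 j)
    imul M acc p) (IV.pt t.2)

/-- Interval evaluation of a polynomial on a box. On a degenerate box it is the evaluation at a
point. -/
def evalPoly (p : Terms n) (B : Box n) : Timed IV :=
  p.foldlM (fun acc t => do
    let v ← monoEval M t B
    iadd M acc v) (IV.pt 0)

/-- The partial derivative with respect to the `j`-th variable, as a list of terms. -/
noncomputable def diffPoly (j : Fin n) : Terms n → Timed (Terms n)
  | [] => pure []
  | t :: p => do
    let q ← diffPoly j p
    if t.1 j = 0 then pure q
    else do
      let c ← qmul M t.2 (t.1 j : ℚ)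
      return (t.1 - Finsupp.single j 1, c) :: q

/-! ### Determinants, strong monotonicity, preconditioning -/

/-- The determinant of the submatrix of an interval matrix with the given rows and columns, by
expansion along its first row. -/
def idet (A : Fin n → Fin n → IV) : List (Fin n) → List (Fin n) → Timed IV
  | [], _ => pure (IV.pt 1)
  | i :: rows, cols => cols.zipIdx.foldlM (fun acc c => do
      let s ← idet A rows (cols.eraseIdx c.2)
      let t ← imul M (A i c.1) s
      if c.2 % 2 = 0 then iadd M acc t else isub M acc t) (IV.pt 0)

/-- An S-M matrix: for every `i`, all submatrices of order `i` of the first `i` rows are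
nonsingular. -/
def IsSM (V : Matrix (Fin n) (Fin n) ℚ) : Prop :=
  ∀ (i : ℕ) (hi : i ≤ n) (c : Fin i ↪o Fin n),
    (V.submatrix (Fin.castLE hi) c).det ≠ 0

/-- The test whether an interval matrix is an S-M matrix: `0 ∉ det A` for all submatrices `A` of
order `i` of the first `i` rows, `1 ≤ i ≤ n`. -/
def isSMTest (A : Fin n → Fin n → IV) : Timed Bool :=
  ((List.range n).flatMap fun i =>
      ((List.finRange n).sublistsLen (i + 1)).map fun cols => (i + 1, cols)).foldlM
    (fun ok p => do
      let D ← idet M A ((List.finRange n).take p.1) p.2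
      let s ← isign M D
      return ok && decide (s ≠ 0)) true

/-- The inverse of a matrix of rational numbers by Cramer's rule, `none` if it is singular. -/
def inverse (A : Fin n → Fin n → IV) : Timed (Option (Fin n → Fin n → IV)) := do
  let D ← idet M A (List.finRange n) (List.finRange n)
  let s ← isign M D
  if s = 0 then return none
  else do
    let X ← tabulate fun i => tabulate fun j => do
      let c ← idet M A ((List.finRange n).erase j) ((List.finRange n).erase i)
      let c' ← if ((i : ℕ) + (j : ℕ)) % 2 = 0 then pure c else isub M (IV.pt 0) c
      idiv M c' D
    return some X

def matMul (A X : Fin n → Fin n → IV) : Timed (Fin n → Fin n → IV) :=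
  tabulate fun i => tabulate fun j => dot M (A i) fun k => X k j

/-- The middle point of a box, as a degenerate box. -/
def middle (B : Box n) : Timed (Box n) :=
  tabulate fun i => do
    let s ← qadd M (B i).lo (B i).hi
    let c ← qdiv M s 2
    return IV.pt c

/-- Evaluation of the Jacobian matrix (given by the lists of terms of its entries) on a box. -/
def evalJac (J : Fin n → Fin n → Terms n) (B : Box n) : Timed (Fin n → Fin n → IV) :=
  tabulate fun i => tabulate fun j => evalPoly M (J i j) B

/-- The matrix `W = V * J_F(m(B))⁻¹`, so that the preconditioned system is `G = W * F`;
`none` if `J_F(m(B))` is singular. -/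
def precond (V : Matrix (Fin n) (Fin n) ℚ) (J : Fin n → Fin n → Terms n) (B : Box n) :
    Timed (Option (Fin n → Fin n → IV)) := do
  let p ← middle M B
  let A ← evalJac M J p
  let X ← inverse M A
  match X with
  | none => return none
  | some X => do
    let W ← matMul M (fun i j => IV.pt (V i j)) X
    return some W

/-- The box predicate: `true` if `0 ∉ □ fᵢ(B)` for some `i`. -/
def exclusion (F : Fin n → Terms n) (B : Box n) : Timed Bool :=
  (List.finRange n).foldlM (fun out i => do
    let I ← evalPoly M (F i) B
    let s ← isign M I
    return out || decide (s ≠ 0)) false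

/-- Evaluation of `g = ∑ j, w j * f j` on a (degenerate) box. -/
def evalComb (F : Fin n → Terms n) (w : Fin n → IV) (B : Box n) : Timed IV := do
  let y ← tabulate fun j => evalPoly M (F j) B
  dot M w y

/-! ### Faces, vertices, bisection -/

/-- A face of a box, possibly of lower dimension: the coordinates that are not listed in `free`
are fixed to (degenerate) intervals. -/
structure Face (n : ℕ) where
  box : Box n
  free : List (Fin n)

def Face.fixLo (B : Face n) (i : Fin n) : Face n :=
  ⟨Function.update B.box i (IV.pt (B.box i).lo), B.free.erase i⟩

def Face.fixHi (B : Face n) (i : Fin n) : Face n :=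
  ⟨Function.update B.box i (IV.pt (B.box i).hi), B.free.erase i⟩

/-- The faces of codimension one. -/
def Face.facets (B : Face n) : List (Face n) :=
  B.free.flatMap fun i => [B.fixLo i, B.fixHi i]

/-- The vertices of the box `B` with respect to the listed coordinates. -/
def vertices : List (Fin n) → Box n → List (Box n)
  | [], B => [B]
  | i :: l, B => vertices l (Function.update B i (IV.pt (B i).lo)) ++
      vertices l (Function.update B i (IV.pt (B i).hi))

/-- The sign of `g` on the set of vertices: `1` or `-1` if it is constantly so, else `0`. -/
def vertexSign (g : Box n → Timed IV) (B : Face n) : Timed ℤ := do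
  let s ← (vertices B.free B.box).foldlM (fun (s : Bool × Bool) v => do
    let I ← g v
    let t ← isign M I
    return (s.1 && decide (t = 1), s.2 && decide (t = -1))) (true, true)
  return if s.1 then 1 else if s.2 then -1 else 0

/-- A widest side (`none` if there is no free coordinate) and the width of a face. -/
def widest (B : Face n) : Timed (Option (Fin n) × ℚ) :=
  B.free.foldlM (fun (acc : Option (Fin n) × ℚ) i => do
    let w ← qsub M (B.box i).hi (B.box i).lo
    let b ← qlt M acc.2 w
    return if b then (some i, w) else acc) (none, 0)

/-- Split a box into two halves in direction `i`. -/
def bisect (B : Box n) (i : Fin n) : Timed (Box n × Box n) := do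
  let s ← qadd M (B i).lo (B i).hi
  let c ← qdiv M s 2
  return (Function.update B i ⟨(B i).lo, c⟩, Function.update B i ⟨c, (B i).hi⟩)

/-! ### The existence test -/

/-- The answers of the existence test: a unique zero, no zero, or undecided. -/
inductive Verdict where
  | one
  | zero
  | unknown

/-- Refine a face that contains a unique zero of its system: bisect a widest side `i` and keep a
half on which the existence test `E` of that system finds the zero. -/
def refine (E : Face n → Timed Verdict) (B : Face n) (i : Fin n) :
    Timed (Option (Face n)) := do
  let H ← bisect M B.box i
  let a ← E ⟨H.1, B.free⟩
  match a with
  | .one => return some ⟨H.1, B.free⟩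
  | _ => do
    let b ← E ⟨H.2, B.free⟩
    match b with
    | .one => return some ⟨H.2, B.free⟩
    | _ => return none

/-- While the width exceeds the precision and the sign `t` of `g` is undetermined, refine the
face; the number of bisections is limited by the first argument. Returns the last sign. -/
def refineLoop (ρ : ℚ) (E : Face n → Timed Verdict) (g : Box n → Timed IV) :
    ℕ → Face n → ℤ → Timed ℤ
  | 0, _, t => pure t
  | r + 1, B, t =>
    if t ≠ 0 then pure t
    else do
      let w ← widest M B
      let big ← exceeds M ρ w.2
      match big, w.1 with
      | true, some i => do
        let B' ← refine M E B i
        match B' with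
        | none => return t
        | some B' => do
          let t' ← vertexSign M g B'
          refineLoop ρ E g r B' t'
      | _, _ => return t

/-- Run through a list of faces, until two of them are found to contain a zero; `none` if the
test is undecided on one of them. -/
def findTwo (E : Face n → Timed Verdict) :
    List (Face n) → List (Face n) → Timed (Option (List (Face n)))
  | [], S => pure (some S)
  | B :: T, S =>
    if 2 ≤ S.length then pure (some S)
    else do
      let b ← E B
      match b with
      | .unknown => return none
      | .zero => findTwo E T S
      | .one => findTwo E T (S ++ [B])

/-- One level of the existence test: `E` is the test for the system without its last function
`g` on the facets. -/
def existenceStep (r : ℕ) (ρ : ℚ) (E : Face n → Timed Verdict) (g : Box n → Timed IV)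
    (B : Face n) : Timed Verdict := do
  let S ← findTwo E B.facets []
  match S with
  | none => return .unknown
  | some [] => return .zero
  | some [B₁, B₂] => do
    let s₁ ← vertexSign M g B₁
    let t₁ ← refineLoop M ρ E g r B₁ s₁
    let s₂ ← vertexSign M g B₂
    let t₂ ← refineLoop M ρ E g r B₂ s₂
    if t₁ * t₂ < 0 then return .one
    else if 0 < t₁ * t₂ then return .zero
    else return .unknown
  | some _ => return .unknown

/-- The existence test for the first `k` functions `g 0, …, g (k - 1)` on a face with `k` free
coordinates. The empty system has a unique zero on a point. -/
def existence (r : ℕ) (ρ : ℚ) (g : ℕ → Box n → Timed IV) : ℕ → Face n → Timed Verdict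
  | 0, _ => pure .one
  | k + 1, B => existenceStep M r ρ (existence r ρ g k) (g k) B

/-! ### The subdivision algorithm -/

/-- What happens to a box: it is thrown away, is an isolating box, is a suspected root box, or
is split into two boxes. -/
inductive Outcome (n : ℕ) where
  | discard
  | isolating
  | suspected
  | split (B₁ B₂ : Box n)

/-- The last part of the loop body, for boxes on which the system is not S-M. -/
def splitOrSuspect (ρ : ℚ) (B : Box n) : Timed (Outcome n) := do
  let w ← widest M ⟨B, List.finRange n⟩
  let big ← exceeds M ρ w.2
  match big, w.1 with
  | true, some i => do
    let H ← bisect M B i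
    return .split H.1 H.2
  | _, _ => return .suspected

/-- The body of the main loop, for a box `B`. -/
def processBox (r : ℕ) (ρ : ℚ) (V : Matrix (Fin n) (Fin n) ℚ)
    (F : Fin n → Terms n) (J : Fin n → Fin n → Terms n) (B : Box n) : Timed (Outcome n) := do
  let out ← exclusion M F B
  if out then return .discard
  else do
    let W ← precond M V J B
    match W with
    | none => splitOrSuspect M ρ B
    | some W => do
      let JB ← evalJac M J B
      let JG ← matMul M W JB
      let sm ← isSMTest M JG
      if sm then do
        let g : ℕ → Box n → Timed IV := fun k P =>
          if h : k < n then evalComb M F (W ⟨k, h⟩) P else pure (IV.pt 0)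
        let v ← existence M r ρ g n ⟨B, List.finRange n⟩
        match v with
        | .one => return .isolating
        | .zero => return .discard
        | .unknown => return .suspected
      else splitOrSuspect M ρ B

/-- The state of the main loop: the boxes still to be treated, the isolating boxes, the suspected
root boxes, and the number of bit operations used so far. -/
structure State (n : ℕ) where
  pending : Multiset (Box n)
  isolating : Multiset (Box n)
  suspected : Multiset (Box n)
  time : ℕ

/-- The effect of the loop body on the state, for a box `B` that has been taken out of the set of
pending boxes; `BS` are the remaining ones. One further bit operation is charged per iteration. -/
def State.update (s : State n) (BS : Multiset (Box n)) (B : Box n) (o : Timed (Outcome n)) :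
    State n :=
  match o.val with
  | .discard => ⟨BS, s.isolating, s.suspected, s.time + o.time + 1⟩
  | .isolating => ⟨BS, B ::ₘ s.isolating, s.suspected, s.time + o.time + 1⟩
  | .suspected => ⟨BS, s.isolating, B ::ₘ s.suspected, s.time + o.time + 1⟩
  | .split B₁ B₂ => ⟨B₁ ::ₘ B₂ ::ₘ BS, s.isolating, s.suspected, s.time + o.time + 1⟩

/-- One iteration of the main loop: an arbitrary pending box is taken and treated. -/
def Step (r : ℕ) (ρ : ℚ) (V : Matrix (Fin n) (Fin n) ℚ)
    (F : Fin n → Terms n) (J : Fin n → Fin n → Terms n) (s s' : State n) : Prop :=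
  ∃ (B : Box n) (BS : Multiset (Box n)), s.pending = B ::ₘ BS ∧
    s' = s.update BS B (processBox M r ρ V F J B)

/-- The Jacobian matrix of the system. -/
noncomputable def jacobian (F : Fin n → Terms n) : Timed (Fin n → Fin n → Terms n) :=
  tabulate fun i => tabulate fun j => diffPoly M j (F i)

/-- The initial state: only the box `[-1,1]^n` is pending, and the Jacobian matrix has been
computed. -/
noncomputable def State.init (F : Fin n → Terms n) : State n :=
  ⟨{fun _ => ⟨-1, 1⟩}, 0, 0, (jacobian M F).time⟩

/-- `s` can be reached from `s₀` by iterations of the main loop. -/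
def Reach (r : ℕ) (ρ : ℚ) (V : Matrix (Fin n) (Fin n) ℚ) (F : Fin n → Terms n)
    (s₀ s : State n) : Prop :=
  Relation.ReflTransGen (Step M r ρ V F (jacobian M F).val) s₀ s

end Algorithm

end RootIsolation

open RootIsolation

/-!
The number of iterations is bounded by a volume argument. A box is bisected only along a widest
side, and only if that side exceeds `ρ`. So, if `K` is minimal with `2 / 2 ^ K ≤ ρ`, all sides have
length `2 / 2 ^ j` with `j ≤ K`, and the volume of a box, in units of `(2 / 2 ^ K) ^ n`, is a
positive integer `w`, additive under bisection. The number `2 w - 1` bounds the iterations that a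
pending box can still cause (`potential`, `LoopInvariant.step`). As `2 ^ K ≤ 4 / ρ`, there are at
most `2 (4 / ρ) ^ n` iterations, whatever the order in which boxes are taken.

For one iteration, the size of the numbers and the number of operations are bounded separately.
All numbers are controlled by a common denominator and a bound for the absolute value (`Rep`).
Endpoints of boxes are multiples of `1 / 2 ^ K` in `[-1, 1]`, so values of the polynomials have
`O(n (K d + τ))` digits, and determinants, common denominators and matrix products cost further
powers of `n` only (`Budget`, `exists_budget`). As `ρ` is bounded away from `1`, `K` is at most a
constant times `-log ρ` (`exists_size_le`), and the growth condition on `M` makes one operation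
cost at most a constant times `n ^ 8 * M ⌈-d log ρ + τ⌉` bit operations. Repeated squaring would
bring in a factor `log d` here; but the sizes of its operands grow geometrically, so that its total
cost is that of the last multiplication (`ipow_within`).

A determinant needs `O(n · n!)` operations, the S-M test `O(n² n!)`, and the existence test
`O(2 ^ n (n + 2 r)!)` up to powers of `n`, since level `k` of its recursion calls level `k - 1` at
most `2 k + 4 r` times (`existence_within`). The factor `2 ^ n` turns `(4 / ρ) ^ n` into
`(8 / ρ) ^ n`. Finally `n ^ n / n!` grows exponentially, so it absorbs all powers of `n`
(`exists_pow_mul_factorial_le`).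
-/

namespace RootIsolation

/-! ### Reasoning about timed computations -/

/-- The computation `x` takes at most `T` bit operations, and its result satisfies `P`. -/
def Within {α : Type} (x : Timed α) (T : ℕ) (P : α → Prop) : Prop :=
  P x.val ∧ x.time ≤ T

namespace Within

variable {α β : Type} {P Q : α → Prop} {R : β → Prop} {a b T : ℕ}

theorem pure {v : α} (h : P v) : Within (Pure.pure v : Timed α) 0 P := ⟨h, le_rfl⟩

theorem bind {x : Timed α} {f : α → Timed β} (hx : Within x a P)
    (hf : ∀ v, P v → Within (f v) b R) : Within (x >>= f) (a + b) R :=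
  ⟨(hf _ hx.1).1, Nat.add_le_add hx.2 (hf _ hx.1).2⟩

theorem le {x : Timed α} (hx : Within x a P) (h : a ≤ b) : Within x b P :=
  ⟨hx.1, hx.2.trans h⟩

theorem imp {x : Timed α} (hx : Within x a P) (h : ∀ v, P v → Q v) : Within x a Q :=
  ⟨h _ hx.1, hx.2⟩

theorem ite {c : Prop} [Decidable c] {x y : Timed α} (hx : c → Within x a P)
    (hy : ¬ c → Within y a P) : Within (if c then x else y) a P := by
  split
  · exact hx ‹_›
  · exact hy ‹_›

theorem tabulate {n : ℕ} {f : Fin n → Timed α} {P : Fin n → α → Prop}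
    (h : ∀ i, Within (f i) a (P i)) :
    Within (RootIsolation.tabulate f) (n * a) (fun v => ∀ i, P i (v i)) := by
  refine ⟨fun i => (h i).1, ?_⟩
  have : ∑ i, (f i).time ≤ ∑ _i : Fin n, a := Finset.sum_le_sum fun i _ => (h i).2
  simpa [RootIsolation.tabulate] using this

/-- A loop over a list, for an invariant that may depend on the number of elements treated. -/
theorem foldlM_of_time {f : β → α → Timed β} (N : ℕ) (I : ℕ → β → Prop) (t : α → ℕ) :
    ∀ (l : List α) (k : ℕ) (v : β), k + l.length ≤ N → I k v →
      (∀ k v, ∀ w ∈ l, k < N → I k v → Within (f v w) (t w) (I (k + 1))) →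
      Within (l.foldlM f v) (l.map t).sum (I (k + l.length))
  | [], k, v, _, hv, _ => by simpa using Within.pure hv
  | w :: l, k, v, hk, hv, h => by
    simp only [List.length_cons] at hk
    have := (h k v w (by simp) (by omega) hv).bind fun u hu =>
      foldlM_of_time N I t l (k + 1) u (by omega) hu
        fun k v w hw => h k v w (List.mem_cons_of_mem _ hw)
    simpa [List.foldlM_cons, add_assoc, add_comm 1] using this

theorem foldlM {f : β → α → Timed β} {l : List α} (I : ℕ → β → Prop) {v : β} (h0 : I 0 v)
    (h : ∀ k v, ∀ w ∈ l, k < l.length → I k v → Within (f v w) T (I (k + 1))) :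
    Within (l.foldlM f v) (l.length * T) (I l.length) := by
  have := foldlM_of_time l.length I (fun _ => T) l 0 v (by simp) h0 h
  simpa using this

end Within

/-! ### Rational numbers with a given denominator and a bounded absolute value -/

/-- `q` can be written with the denominator `D`, not necessarily in lowest terms, and `|q| ≤ H`.
Fixing `D` keeps long sums small: adding numbers with the same `D` does not change it. -/
def Rep (D H : ℕ) (q : ℚ) : Prop := (∃ z : ℤ, q = z / D) ∧ |q| ≤ H

/-- Rational numbers with the denominator `D` and of absolute value at most `H` have numerators
and denominators of at most `S` binary digits, hence bit size at most `2 S`, and an operation on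
two of them costs at most `M (4 S)`. -/
def Fits (S D H : ℕ) : Prop := 0 < D ∧ D < 2 ^ S ∧ D * H < 2 ^ S

namespace Fits

variable {S D D' H H' : ℕ}

theorem mono (h : Fits S D H) (hD0 : 0 < D') (hD : D' ≤ D) (hH : H' ≤ H) : Fits S D' H' :=
  ⟨hD0, hD.trans_lt h.2.1, (Nat.mul_le_mul hD hH).trans_lt h.2.2⟩

theorem mono_right (h : Fits S D H) (hH : H' ≤ H) : Fits S D H' := h.mono h.1 le_rfl hH

theorem left (h : Fits S (D * D') (H * H')) (hH : 0 < H') : Fits S D H := by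
  have := Nat.pos_of_mul_pos_left h.1
  have h2 := Nat.pos_of_mul_pos_right h.1
  refine h.mono ‹_› ?_ ?_
  · exact Nat.le_mul_of_pos_right _ ‹_›
  · exact Nat.le_mul_of_pos_right _ ‹_›

theorem right (h : Fits S (D * D') (H * H')) (hH : 0 < H) : Fits S D' H' := by
  rw [mul_comm D, mul_comm H] at h
  exact h.left hH

end Fits

namespace Rep

variable {S D D' H H' : ℕ} {x y : ℚ}

theorem bitSize_le (hx : Rep D H x) (h : Fits S D H) : bitSize x ≤ 2 * S := by
  obtain ⟨⟨z, hz⟩, hH⟩ := hx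
  have hd : x.den ∣ D := by
    have := Rat.den_dvd z D
    rw [hz]
    exact_mod_cast this
  have hle := Nat.le_of_dvd h.1 hd
  have h1 : Nat.size x.den ≤ S := Nat.size_le.2 (hle.trans_lt h.2.1)
  have h2 : Nat.size x.num.natAbs ≤ S := by
    refine Nat.size_le.2 (lt_of_le_of_lt ?_ h.2.2)
    have h3 : ((x.num.natAbs : ℕ) : ℚ) = x.den * |x| := by
      have h4 : (x.num : ℚ) = x.den * x := (Rat.den_mul_eq_num x).symm
      rw [Nat.cast_natAbs, Int.cast_abs, h4, abs_mul, Nat.abs_cast]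
    have h5 : ((x.num.natAbs : ℕ) : ℚ) ≤ D * H := by
      rw [h3]
      have : (x.den : ℚ) ≤ D := by exact_mod_cast hle
      gcongr
    exact_mod_cast h5
  unfold bitSize
  omega

theorem mono (hx : Rep D H x) (hD0 : 0 < D') (hD : D ∣ D') (hH : H ≤ H') : Rep D' H' x := by
  obtain ⟨⟨z, hz⟩, hH'⟩ := hx
  obtain ⟨c, rfl⟩ := hD
  have h0 := Nat.pos_of_mul_pos_right hD0
  have h1 := Nat.pos_of_mul_pos_left hD0
  refine ⟨⟨z * c, ?_⟩, hH'.trans (by exact_mod_cast hH)⟩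
  rw [hz]
  push_cast
  field_simp

theorem mono_right (hx : Rep D H x) (hH : H ≤ H') : Rep D H' x :=
  ⟨hx.1, hx.2.trans (by exact_mod_cast hH)⟩

theorem zero : Rep D H 0 := ⟨⟨0, by simp⟩, by simp⟩

theorem one (hD : 0 < D) (hH : 0 < H) : Rep D H 1 :=
  ⟨⟨D, by have : (D : ℚ) ≠ 0 := by positivity
          push_cast; field_simp⟩, by simpa using Nat.succ_le_of_lt hH⟩

theorem neg (hx : Rep D H x) : Rep D H (-x) := by
  obtain ⟨⟨z, hz⟩, hH⟩ := hx
  exact ⟨⟨-z, by rw [hz]; push_cast; ring⟩, by simpa using hH⟩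

theorem add (hx : Rep D H x) (hy : Rep D H' y) : Rep D (H + H') (x + y) := by
  obtain ⟨⟨z, hz⟩, hH⟩ := hx
  obtain ⟨⟨w, hw⟩, hH'⟩ := hy
  refine ⟨⟨z + w, by rw [hz, hw]; push_cast; ring⟩, (abs_add_le x y).trans ?_⟩
  push_cast
  linarith

theorem sub (hx : Rep D H x) (hy : Rep D H' y) : Rep D (H + H') (x - y) := by
  rw [sub_eq_add_neg]
  exact hx.add hy.neg

theorem mul (hx : Rep D H x) (hy : Rep D' H' y) : Rep (D * D') (H * H') (x * y) := by
  obtain ⟨⟨z, hz⟩, hH⟩ := hx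
  obtain ⟨⟨w, hw⟩, hH'⟩ := hy
  refine ⟨⟨z * w, by rw [hz, hw]; push_cast; rw [div_mul_div_comm]⟩, ?_⟩
  rw [abs_mul]
  push_cast
  gcongr

theorem min (hx : Rep D H x) (hy : Rep D H y) : Rep D H (min x y) := by
  rcases min_choice x y with h | h <;> rw [h] <;> assumption

theorem max (hx : Rep D H x) (hy : Rep D H y) : Rep D H (max x y) := by
  rcases max_choice x y with h | h <;> rw [h] <;> assumption

/-- The reciprocal exchanges the roles of numerator and denominator. For `x = 0` this holds with
the value `0⁻¹ = 0`, so that no sign information is needed to bound sizes. -/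
theorem inv (hx : Rep D H x) (hD : 0 < D) : Rep x⁻¹.den D x⁻¹ := by
  refine ⟨⟨x⁻¹.num, (Rat.num_div_den _).symm⟩, ?_⟩
  obtain ⟨⟨z, hz⟩, -⟩ := hx
  rcases eq_or_ne z 0 with rfl | hz0
  · simp [hz]
  · rw [hz, inv_div, abs_div, Nat.abs_cast]
    refine div_le_self (by positivity) ?_
    rw [← Int.cast_abs]
    exact_mod_cast Int.one_le_abs hz0

theorem den_inv_le (hx : Rep D H x) (hD : 0 < D) (hH : 0 < H) : x⁻¹.den ≤ D * H := by
  obtain ⟨⟨z, hz⟩, hz'⟩ := hx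
  have hD' : (0 : ℚ) < D := by exact_mod_cast hD
  rcases eq_or_ne z 0 with rfl | hz0
  · have : 0 < D * H := by positivity
    simp [hz]
    omega
  · have h1 : x⁻¹.den ∣ z.natAbs := by
      have := Rat.den_dvd D z
      rw [hz, inv_div]
      rw [← Int.natCast_dvd_natCast, Int.dvd_natAbs]
      exact_mod_cast this
    refine (Nat.le_of_dvd (Int.natAbs_pos.2 hz0) h1).trans ?_
    have : ((z.natAbs : ℕ) : ℚ) ≤ D * H := by
      rw [Nat.cast_natAbs, Int.cast_abs]
      have : (z : ℚ) = D * x := by rw [hz]; field_simp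
      rw [this, abs_mul, Nat.abs_cast]
      gcongr
    exact_mod_cast this

end Rep

/-- Both endpoints of `I` have the denominator `D` and absolute value at most `H`. -/
def IRep (D H : ℕ) (I : IV) : Prop := Rep D H I.lo ∧ Rep D H I.hi

namespace IRep

variable {D D' H H' : ℕ} {I : IV}

theorem mono (h : IRep D H I) (hD0 : 0 < D') (hD : D ∣ D') (hH : H ≤ H') : IRep D' H' I :=
  ⟨h.1.mono hD0 hD hH, h.2.mono hD0 hD hH⟩

theorem mono_right (h : IRep D H I) (hH : H ≤ H') : IRep D H' I :=
  ⟨h.1.mono_right hH, h.2.mono_right hH⟩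

theorem pt {q : ℚ} (h : Rep D H q) : IRep D H (IV.pt q) := ⟨h, h⟩

end IRep

/-! ### The cost of interval arithmetic -/

namespace IsArithCost

variable {M : ℕ → ℕ}

theorem mono (hM : IsArithCost M) : Monotone M := fun s t h => by
  have := hM.add_le s (t - s)
  rw [Nat.add_sub_cancel' h] at this
  omega

end IsArithCost

section Cost

variable {M : ℕ → ℕ} {S : ℕ}

theorem qop_within {α : Type} (hM : IsArithCost M) {D D' H H' : ℕ} {x y : ℚ} {v : α}
    (hx : Rep D H x) (hy : Rep D' H' y) (h : Fits S D H) (h' : Fits S D' H') :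
    Within (qop M x y v) (M (4 * S)) (· = v) :=
  ⟨rfl, hM.mono (by have := hx.bitSize_le h; have := hy.bitSize_le h'; omega)⟩

theorem iadd_within (hM : IsArithCost M) {D H H' : ℕ} {I J : IV} (hI : IRep D H I)
    (hJ : IRep D H' J) (h : Fits S D (H + H')) :
    Within (iadd M I J) (2 * M (4 * S)) (IRep D (H + H')) := by
  have h1 : Fits S D H := h.mono_right (by omega)
  have h2 : Fits S D H' := h.mono_right (by omega)
  refine ((qop_within hM hI.1 hJ.1 h1 h2).bind fun a ha =>
    (qop_within hM hI.2 hJ.2 h1 h2).bind fun b hb => .pure ?_).le (by omega)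
  subst ha hb
  exact ⟨hI.1.add hJ.1, hI.2.add hJ.2⟩

theorem isub_within (hM : IsArithCost M) {D H H' : ℕ} {I J : IV} (hI : IRep D H I)
    (hJ : IRep D H' J) (h : Fits S D (H + H')) :
    Within (isub M I J) (2 * M (4 * S)) (IRep D (H + H')) := by
  have h1 : Fits S D H := h.mono_right (by omega)
  have h2 : Fits S D H' := h.mono_right (by omega)
  refine ((qop_within hM hI.1 hJ.2 h1 h2).bind fun a ha =>
    (qop_within hM hI.2 hJ.1 h1 h2).bind fun b hb => .pure ?_).le (by omega)
  subst ha hb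
  exact ⟨hI.1.sub hJ.2, hI.2.sub hJ.1⟩

theorem imul_within (hM : IsArithCost M) {D D' H H' : ℕ} {I J : IV} (hI : IRep D H I)
    (hJ : IRep D' H' J) (hH : 0 < H) (hH' : 0 < H') (h : Fits S (D * D') (H * H')) :
    Within (imul M I J) (10 * M (4 * S)) (IRep (D * D') (H * H')) := by
  have h1 := h.left hH'
  have h2 := h.right hH
  refine ((qop_within hM hI.1 hJ.1 h1 h2).bind fun p hp =>
    (qop_within hM hI.1 hJ.2 h1 h2).bind fun q hq =>
    (qop_within hM hI.2 hJ.1 h1 h2).bind fun r hr =>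
    (qop_within hM hI.2 hJ.2 h1 h2).bind fun s hs => ?_).le
      (b := 10 * M (4 * S)) (a := M (4 * S) + (M (4 * S) + (M (4 * S) + (M (4 * S) +
        6 * M (4 * S))))) (by omega)
  have hp' : Rep (D * D') (H * H') p := hp ▸ hI.1.mul hJ.1
  have hq' : Rep (D * D') (H * H') q := hq ▸ hI.1.mul hJ.2
  have hr' : Rep (D * D') (H * H') r := hr ▸ hI.2.mul hJ.1
  have hs' : Rep (D * D') (H * H') s := hs ▸ hI.2.mul hJ.2
  have a1 := hp'.min hq'
  have a2 := hr'.min hs'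
  have b1 := hp'.max hq'
  have b2 := hr'.max hs'
  refine ((qop_within hM hp' hq' h h).bind fun _ e1 =>
    (qop_within hM hr' hs' h h).bind fun _ e2 => ?_).le
      (a := M (4 * S) + (M (4 * S) + 4 * M (4 * S))) (by omega)
  subst e1 e2
  refine ((qop_within hM a1 a2 h h).bind fun _ e1 =>
    (qop_within hM hp' hq' h h).bind fun _ e2 =>
    (qop_within hM hr' hs' h h).bind fun _ e3 => ?_).le
      (a := M (4 * S) + (M (4 * S) + (M (4 * S) + M (4 * S)))) (by omega)
  subst e1 e2 e3
  refine ((qop_within hM b1 b2 h h).bind fun _ e1 => .pure ?_)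
  subst e1
  exact ⟨a1.min a2, b1.max b2⟩

theorem isign_within (hM : IsArithCost M) {D H : ℕ} {I : IV} (hI : IRep D H I)
    (h : Fits S D H) : Within (isign M I) (2 * M (4 * S)) (fun _ => True) :=
  ((qop_within hM (Rep.zero (D := D) (H := H)) hI.1 h h).bind fun _ _ =>
    (qop_within hM hI.2 (Rep.zero (D := D) (H := H)) h h).bind fun _ _ => .pure trivial).le
    (by omega)

/-- The denominators of the reciprocals of the endpoints of `J` do not depend on `I`: this is what
gives a common denominator to all entries of a matrix that are divided by `J`. -/
theorem idiv_within (hM : IsArithCost M) {D D' H H' : ℕ} {I J : IV} (hI : IRep D H I)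
    (hJ : IRep D' H' J) (hH : 0 < H) (hD' : 0 < D') (hH' : 0 < H') (hJf : Fits S D' H')
    (h : Fits S (D * ((D' * H') * (D' * H'))) (H * D')) :
    Within (idiv M I J) (12 * M (4 * S)) (IRep (D * (J.hi⁻¹.den * J.lo⁻¹.den)) (H * D')) := by
  have h1 := hJ.1.den_inv_le hD' hH'
  have h2 := hJ.2.den_inv_le hD' hH'
  have p1 := J.lo⁻¹.den_pos
  have p2 := J.hi⁻¹.den_pos
  have hD := Nat.pos_of_mul_pos_right h.1
  have one : Rep 1 1 1 := Rep.one one_pos one_pos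
  have h11 : Fits S 1 1 := hJf.mono one_pos hD' hH'
  have hb : J.hi⁻¹.den * J.lo⁻¹.den ≤ D' * H' * (D' * H') := Nat.mul_le_mul h2 h1
  refine ((qop_within hM one hJ.2 h11 hJf).bind fun a ha =>
    (qop_within hM one hJ.1 h11 hJf).bind fun b hb' =>
    imul_within hM (S := S) hI (J := ⟨a, b⟩) ⟨?_, ?_⟩ hH hD' ?_).le (by omega)
  · rw [ha, one_div]
    exact (hJ.2.inv hD').mono (by positivity) (Dvd.intro _ rfl) le_rfl
  · rw [hb', one_div]
    exact (hJ.1.inv hD').mono (by positivity) (Dvd.intro_left _ rfl) le_rfl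
  · exact h.mono (by positivity) (Nat.mul_le_mul_left _ hb) le_rfl

/-- Repeated squaring costs no more than a constant times its last multiplication, since the
sizes of the operands grow geometrically and the cost of multiplication is superadditive. -/
theorem ipow_within (hM : IsArithCost M) {k : ℕ} (hk : 0 < k) {I : IV} (hI : IRep (2 ^ k) 1 I) :
    ∀ e : ℕ, Within (ipow M I e) (40 * M (8 * (k * e))) (IRep (2 ^ (k * e)) 1) := by
  intro e
  induction e using Nat.strong_induction_on with
  | _ e ih =>
  unfold ipow
  refine Within.ite (fun h => ?_) (fun h => ?_)
  · exact (Within.pure (IRep.pt (Rep.one (by positivity) one_pos))).le (by omega)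
  · have hlt : e / 2 < e := by omega
    have hfit : ∀ j ≤ e, Fits (2 * (k * e)) (2 ^ (k * j)) 1 := fun j hj => by
      have : k * j ≤ k * e := Nat.mul_le_mul_left _ hj
      have : 0 < k * e := by positivity
      have h2 : 2 ^ (k * j) < 2 ^ (2 * (k * e)) := Nat.pow_lt_pow_right (by omega) (by omega)
      exact ⟨by positivity, h2, by simpa using h2⟩
    have hhalf : 2 * M (8 * (k * (e / 2))) ≤ M (8 * (k * e)) := by
      have h1 := hM.add_le (8 * (k * (e / 2))) (8 * (k * (e / 2)))
      have h2 : 8 * (k * (e / 2)) + 8 * (k * (e / 2)) ≤ 8 * (k * e) := by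
        have : e / 2 + e / 2 ≤ e := by omega
        have := Nat.mul_le_mul_left (8 * k) this
        nlinarith
      have := hM.mono h2
      omega
    have h4 : 4 * (2 * (k * e)) = 8 * (k * e) := by ring
    refine (((ih _ hlt).bind fun p hp => ?_).le
      (a := 40 * M (8 * (k * (e / 2))) + 20 * M (8 * (k * e)))) (by omega)
    have hs := imul_within hM (S := 2 * (k * e)) hp hp one_pos one_pos (by
      rw [← pow_add, ← mul_add]
      exact hfit _ (by omega))
    rw [h4] at hs
    refine (hs.bind fun s hs => ?_).le
      (a := 10 * M (8 * (k * e)) + 10 * M (8 * (k * e))) (by omega)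
    rw [← pow_add, ← mul_add] at hs
    refine Within.ite (fun h => ?_) (fun h => ?_)
    · have : e / 2 + e / 2 = e := by omega
      rw [this] at hs
      exact (Within.pure hs).le (by omega)
    · have he : k * (e / 2 + e / 2) + k = k * e := by
        have : e / 2 + e / 2 + 1 = e := by omega
        calc _ = k * (e / 2 + e / 2 + 1) := by ring
          _ = _ := by rw [this]
      have := imul_within hM (S := 2 * (k * e)) hs hI one_pos one_pos (by
        rw [← pow_add, he]
        exact hfit _ le_rfl)
      rw [← pow_add, he, h4] at this
      exact this

end Cost

/-! ### The cost of evaluating polynomials -/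

section Poly

variable {M : ℕ → ℕ} {S n : ℕ}

/-- The terms have degree at most `d` and integer coefficients of absolute value at most `C`. -/
def TermsBound (d C : ℕ) (p : Terms n) : Prop :=
  ∀ t ∈ p, ∑ j, t.1 j ≤ d ∧ Rep 1 C t.2

theorem monoEval_within (hM : IsArithCost M) {k d C : ℕ} (hk : 0 < k) (hC : 0 < C)
    (hS : 2 * (k * d) ≤ S) (hf : Fits S (2 ^ (k * d)) C) {t : (Fin n →₀ ℕ) × ℚ}
    (ht : ∑ j, t.1 j ≤ d) (ht' : Rep 1 C t.2) {B : Box n} (hB : ∀ j, IRep (2 ^ k) 1 (B j)) :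
    Within (monoEval M t B) (n * (50 * M (4 * S))) (IRep (2 ^ (k * d)) C) := by
  have hle : ∀ j, t.1 j ≤ d := fun j =>
    (Finset.single_le_sum (f := fun j => t.1 j) (fun _ _ => Nat.zero_le _)
      (Finset.mem_univ j)).trans ht
  -- the exponent of the common denominator is `k` times the degree of the factors treated so far
  have key : ∀ (l : List (Fin n)) (acc : IV) (a : ℕ), a + (l.map t.1).sum ≤ d →
      IRep (2 ^ (k * a)) C acc →
      Within (l.foldlM (fun acc j => do
        let p ← ipow M (B j) (t.1 j)
        imul M acc p) acc) (l.length * (50 * M (4 * S))) (IRep (2 ^ (k * d)) C) := by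
    intro l
    induction l with
    | nil =>
      intro acc a ha hacc
      refine (Within.pure (hacc.mono (by positivity) ?_ le_rfl)).le (by omega)
      exact pow_dvd_pow _ (Nat.mul_le_mul_left _ (by simpa using ha))
    | cons j l ih =>
      intro acc a ha hacc
      simp only [List.map_cons, List.sum_cons] at ha
      rw [List.foldlM_cons]
      have hmul : 2 ^ (k * a) * 2 ^ (k * t.1 j) = 2 ^ (k * (a + t.1 j)) := by
        rw [← pow_add, ← mul_add]
      have hfit : Fits S (2 ^ (k * a) * 2 ^ (k * t.1 j)) (C * 1) := by
        rw [hmul, mul_one]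
        exact hf.mono (by positivity)
          (Nat.pow_le_pow_right two_pos (Nat.mul_le_mul_left _ (by omega))) le_rfl
      have hp : 40 * M (8 * (k * t.1 j)) ≤ 40 * M (4 * S) := by
        have := Nat.mul_le_mul_left k (hle j)
        exact Nat.mul_le_mul_left _ (hM.mono (by omega))
      refine ((((ipow_within hM hk (hB j) (t.1 j)).le hp).bind fun p hp =>
        imul_within hM hacc hp hC one_pos hfit).bind fun v hv => ih v (a + t.1 j) (by omega) ?_).le
          ?_
      · rwa [hmul, mul_one] at hv
      · rw [List.length_cons, add_mul]
        omega
  have := key (List.finRange n) (IV.pt t.2) 0 (by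
    rw [zero_add, ← List.ofFn_eq_map, List.sum_ofFn]; exact ht) (by simpa using IRep.pt ht')
  rwa [List.length_finRange] at this

theorem evalPoly_within (hM : IsArithCost M) {k d C m : ℕ} (hk : 0 < k) (hC : 0 < C) (hm : 0 < m)
    (hS : 2 * (k * d) ≤ S) (hf : Fits S (2 ^ (k * d)) (m * C)) {p : Terms n}
    (hp : TermsBound d C p) (hpm : p.length ≤ m) {B : Box n} (hB : ∀ j, IRep (2 ^ k) 1 (B j)) :
    Within (evalPoly M p B) (p.length * (n * (50 * M (4 * S)) + 2 * M (4 * S)))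
      (IRep (2 ^ (k * d)) (m * C)) := by
  have := Within.foldlM (l := p) (f := fun acc t => do
      let v ← monoEval M t B
      iadd M acc v) (T := n * (50 * M (4 * S)) + 2 * M (4 * S))
    (fun i acc => IRep (2 ^ (k * d)) (i * C) acc) (v := IV.pt 0) (IRep.pt Rep.zero)
    (fun i acc t ht hi hacc => by
      have h1 : (i + 1) * C ≤ m * C := Nat.mul_le_mul_right _ (by omega)
      have h2 : C ≤ m * C := Nat.le_mul_of_pos_left _ hm
      have h3 : i * C + C = (i + 1) * C := by ring
      rw [← h3] at h1
      refine (monoEval_within hM hk hC hS (hf.mono_right h2) (hp t ht).1 (hp t ht).2 hB).bind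
        fun v hv => ?_
      rw [← h3]
      exact iadd_within hM hacc hv (hf.mono_right h1))
  exact this.imp fun v hv => hv.mono_right (Nat.mul_le_mul_right _ hpm)

theorem diffPoly_within (hM : IsArithCost M) {d C : ℕ} (hd : 0 < d) (hC : 0 < C)
    (hf : Fits S 1 (C * d)) (j : Fin n) : ∀ {p : Terms n}, TermsBound d C p →
    Within (diffPoly M j p) (p.length * M (4 * S))
      (fun q => TermsBound d (C * d) q ∧ q.length ≤ p.length)
  | [], _ => Within.le (Within.pure ⟨by simp [TermsBound], le_rfl⟩) (Nat.zero_le _)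
  | t :: p, hp => by
    have ht := hp t (by simp)
    have hle : t.1 j ≤ d := (Finset.single_le_sum (f := fun j => t.1 j)
      (fun _ _ => Nat.zero_le _) (Finset.mem_univ j)).trans ht.1
    have h1 : Fits S 1 C := hf.mono_right (Nat.le_mul_of_pos_right _ hd)
    have h2 : Fits S 1 d := hf.mono_right (Nat.le_mul_of_pos_left _ hC)
    have hexp : Rep 1 d (t.1 j : ℚ) := ⟨⟨t.1 j, by simp⟩, by simpa using hle⟩
    unfold diffPoly
    rw [List.length_cons, add_mul, one_mul]
    refine (diffPoly_within hM hd hC hf j (p := p) fun u hu => hp u (by simp [hu])).bind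
      fun q hq => Within.ite (fun _ => ?_) (fun _ => ?_)
    · exact Within.le (Within.pure ⟨hq.1, hq.2.trans (Nat.le_succ _)⟩) (Nat.zero_le _)
    · refine ((qop_within hM ht.2 hexp h1 h2).bind fun c hc => Within.pure ⟨?_, ?_⟩).le le_rfl
      · intro u hu
        rcases List.mem_cons.1 hu with rfl | hu
        · refine ⟨(Finset.sum_le_sum fun i _ => ?_).trans ht.1, ?_⟩
          · simp
          · subst hc
            exact ht.2.mul hexp
        · exact hq.1 u hu
      · simpa using hq.2

/-! ### The cost of linear algebra -/

/-- Laplace expansion of order `l` takes at most `l * l!` steps; the product of `l` entries has the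
denominator `D ^ l`, which is common to all partial sums. -/
theorem idet_within (hM : IsArithCost M) {D H : ℕ} (hD : 0 < D) (hH : 0 < H) (hn : 0 < n)
    (hf : Fits S (D ^ n) ((n * H) ^ n)) {A : Fin n → Fin n → IV}
    (hA : ∀ i j, IRep D H (A i j)) :
    ∀ (rows cols : List (Fin n)), rows.length ≤ n → cols.length = rows.length →
      Within (idet M A rows cols) (12 * M (4 * S) * (rows.length * rows.length.factorial))
        (IRep (D ^ rows.length) ((n * H) ^ rows.length)) := by
  intro rows
  have hnH : 0 < n * H := by positivity
  induction rows with
  | nil =>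
    intro cols _ _
    simp only [idet, List.length_nil, pow_zero]
    exact (Within.pure (IRep.pt (Rep.one one_pos one_pos))).le (Nat.zero_le _)
  | cons i rows ih =>
    intro cols hr hc
    simp only [idet]
    set L := rows.length with hL
    have hlen : (i :: rows).length = L + 1 := rfl
    rw [hlen] at hr hc ⊢
    set X := H * (n * H) ^ L with hX
    have hXn : n * X = (n * H) ^ (L + 1) := by rw [hX, pow_succ]; ring
    have hfit : Fits S (D ^ (L + 1)) ((n * H) ^ (L + 1)) :=
      hf.mono (by positivity) (Nat.pow_le_pow_right hD hr) (Nat.pow_le_pow_right hnH hr)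
    set T := 12 * M (4 * S) * (L * L.factorial)
    have := Within.foldlM (l := cols.zipIdx) (f := fun acc c => do
        let s ← idet M A rows (cols.eraseIdx c.2)
        let t ← imul M (A i c.1) s
        if c.2 % 2 = 0 then iadd M acc t else isub M acc t) (T := T + 12 * M (4 * S))
      (fun j acc => IRep (D ^ (L + 1)) (j * X) acc) (v := IV.pt 0) (IRep.pt Rep.zero)
      (fun j acc c hcm hj hacc => by
        rw [List.length_zipIdx, hc] at hj
        have hc2 : c.2 < cols.length := by
          have := List.snd_lt_add_of_mem_zipIdx hcm
          omega
        refine ((ih (cols.eraseIdx c.2) (by omega) ?_).bind fun s hs => ?_)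
        · rw [List.length_eraseIdx_of_lt hc2]; omega
        have hsum : (j + 1) * X ≤ (n * H) ^ (L + 1) := by
          rw [← hXn]; exact Nat.mul_le_mul_right _ (by omega)
        have hX1 : X ≤ (n * H) ^ (L + 1) := by
          rw [← hXn]; exact Nat.le_mul_of_pos_left _ hn
        have hDD : D * D ^ L = D ^ (L + 1) := by ring
        have h3 : (j + 1) * X = j * X + X := by ring
        have hmul := imul_within hM (S := S) (hA i c.1) hs hH (by positivity) (by
          rw [hDD]; exact hfit.mono_right hX1)
        rw [hDD] at hmul
        rw [h3] at hsum ⊢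
        refine (hmul.bind fun t ht => Within.ite (fun _ => ?_) (fun _ => ?_)).le
          (a := 10 * M (4 * S) + 2 * M (4 * S)) (by omega)
        · exact iadd_within hM hacc ht (hfit.mono_right hsum)
        · exact isub_within hM hacc ht (hfit.mono_right hsum))
    rw [List.length_zipIdx, hc] at this
    refine (this.imp fun v hv => hv.mono_right ?_).le ?_
    · rw [← hXn]; exact Nat.mul_le_mul_right _ (by omega)
    · have h1 : 1 ≤ L.factorial := Nat.one_le_iff_ne_zero.2 L.factorial_ne_zero
      calc (L + 1) * (T + 12 * M (4 * S))
          = 12 * M (4 * S) * ((L + 1) * (L * L.factorial + 1)) := by simp only [T]; ring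
        _ ≤ 12 * M (4 * S) * ((L + 1) * (L * L.factorial + L.factorial)) := by gcongr
        _ = _ := by rw [Nat.factorial_succ]; ring

theorem dot_within (hM : IsArithCost M) {D D' H H' : ℕ} (hH : 0 < H) (hH' : 0 < H') (hn : 0 < n)
    (hf : Fits S (D * D') (n * (H * H'))) {A X : Fin n → IV} (hA : ∀ j, IRep D H (A j))
    (hX : ∀ j, IRep D' H' (X j)) :
    Within (dot M A X) (n * (12 * M (4 * S))) (IRep (D * D') (n * (H * H'))) := by
  have := Within.foldlM (l := List.finRange n) (f := fun acc j => do
      let t ← imul M (A j) (X j)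
      iadd M acc t) (T := 12 * M (4 * S))
    (fun i acc => IRep (D * D') (i * (H * H')) acc) (v := IV.pt 0) (IRep.pt Rep.zero)
    (fun i acc j _ hi hacc => by
      rw [List.length_finRange] at hi
      have h1 : (i + 1) * (H * H') ≤ n * (H * H') := Nat.mul_le_mul_right _ (by omega)
      have h2 : H * H' ≤ n * (H * H') := Nat.le_mul_of_pos_left _ hn
      have h3 : (i + 1) * (H * H') = i * (H * H') + H * H' := by ring
      rw [h3] at h1 ⊢
      exact ((imul_within hM (hA j) (hX j) hH hH' (hf.mono_right h2)).bind fun t ht =>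
        iadd_within hM hacc ht (hf.mono_right h1)).le (by omega))
  rwa [List.length_finRange] at this

theorem matMul_within (hM : IsArithCost M) {D D' H H' : ℕ} (hH : 0 < H) (hH' : 0 < H')
    (hn : 0 < n) (hf : Fits S (D * D') (n * (H * H'))) {A X : Fin n → Fin n → IV}
    (hA : ∀ i j, IRep D H (A i j)) (hX : ∀ i j, IRep D' H' (X i j)) :
    Within (matMul M A X) (n * (n * (n * (12 * M (4 * S)))))
      (fun Y => ∀ i j, IRep (D * D') (n * (H * H')) (Y i j)) :=
  Within.tabulate fun i => Within.tabulate fun j =>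
    dot_within hM hH hH' hn hf (hA i) fun k => hX k j

/-- The S-M test computes `n.choose i` determinants of order `i`, and `n.choose i * i! ≤ n!`. -/
theorem sum_choose_mul_factorial_le (n : ℕ) (a b : ℕ) :
    (((List.range n).flatMap fun i => ((List.finRange n).sublistsLen (i + 1)).map
      fun cols => (i + 1, cols)).map fun p : ℕ × List (Fin n) =>
        a * (p.1 * p.1.factorial) + b).sum ≤ n * (n.factorial * (a * n + b)) := by
  have h : ∀ i < n, (n.choose (i + 1)) * (a * ((i + 1) * (i + 1).factorial) + b) ≤
      n.factorial * (a * n + b) := fun i hi => by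
    have h1 : n.choose (i + 1) * (i + 1).factorial ≤ n.factorial := by
      rw [← Nat.choose_mul_factorial_mul_factorial (show i + 1 ≤ n from hi)]
      exact Nat.le_mul_of_pos_right _ (Nat.factorial_pos _)
    have h2 : 1 ≤ (i + 1).factorial := Nat.factorial_pos _
    calc n.choose (i + 1) * (a * ((i + 1) * (i + 1).factorial) + b)
        ≤ n.choose (i + 1) * (a * (n * (i + 1).factorial) + b * (i + 1).factorial) := by
          gcongr
          · exact hi
          · exact Nat.le_mul_of_pos_right _ h2
      _ = (n.choose (i + 1) * (i + 1).factorial) * (a * n + b) := by ring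
      _ ≤ _ := Nat.mul_le_mul_right _ h1
  rw [List.map_flatMap, List.flatMap_def, List.sum_flatten]
  simp only [List.map_map, Function.comp_def, List.map_const', List.sum_replicate,
    List.length_sublistsLen, List.length_finRange, smul_eq_mul]
  have := List.sum_le_card_nsmul ((List.range n).map fun i =>
    (n.choose (i + 1)) * (a * ((i + 1) * (i + 1).factorial) + b)) (n.factorial * (a * n + b)) (by
      intro x hx
      obtain ⟨i, hi, rfl⟩ := List.mem_map.1 hx
      exact h i (List.mem_range.1 hi))
  simpa using this

theorem isSMTest_within (hM : IsArithCost M) {D H : ℕ} (hD : 0 < D) (hH : 0 < H) (hn : 0 < n)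
    (hf : Fits S (D ^ n) ((n * H) ^ n)) {A : Fin n → Fin n → IV}
    (hA : ∀ i j, IRep D H (A i j)) :
    Within (isSMTest M A) (n * (n.factorial * (12 * M (4 * S) * n + 2 * M (4 * S))))
      (fun _ => True) := by
  have hnH : 0 < n * H := by positivity
  refine (Within.foldlM_of_time _ (fun _ _ => True)
    (fun p => 12 * M (4 * S) * (p.1 * p.1.factorial) + 2 * M (4 * S)) _ 0 true le_rfl
      trivial ?_).le (sum_choose_mul_factorial_le n _ _)
  intro k ok p hp _ _
  obtain ⟨i, hi, hp⟩ := List.mem_flatMap.1 hp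
  obtain ⟨cols, hcols, rfl⟩ := List.mem_map.1 hp
  rw [List.mem_range] at hi
  rw [List.mem_sublistsLen] at hcols
  have hlen : ((List.finRange n).take (i + 1)).length = i + 1 := by
    simp; omega
  have := idet_within hM hD hH hn hf hA ((List.finRange n).take (i + 1)) cols (by omega)
    (by rw [hlen, hcols.2])
  rw [hlen] at this
  exact (this.bind fun v hv => (isign_within hM hv (hf.mono (by positivity)
    (Nat.pow_le_pow_right hD hi) (Nat.pow_le_pow_right hnH hi))).bind fun _ _ =>
      Within.pure trivial)

/-- Cramer's rule: all entries of the inverse are given with a common denominator, the product of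
that of the minors and of the numerators of the endpoints of the determinant. -/
theorem inverse_within (hM : IsArithCost M) {D H D₂ H₂ : ℕ} (hD : 0 < D) (hH : 0 < H)
    (hn : 0 < n) (hD₂ : D₂ = D ^ n) (hH₂ : H₂ = (n * H) ^ n)
    (hf : Fits S (D₂ * ((D₂ * H₂) * (D₂ * H₂))) (2 * H₂ * D₂)) {A : Fin n → Fin n → IV}
    (hA : ∀ i j, IRep D H (A i j)) :
    Within (inverse M A)
      ((n * n + 1) * (12 * M (4 * S) * (n * n.factorial) + 14 * M (4 * S)))
      (fun X => ∀ Y, X = some Y → ∃ E, 0 < E ∧ E ≤ D₂ * ((D₂ * H₂) * (D₂ * H₂)) ∧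
        ∀ i j, IRep E (2 * H₂ * D₂) (Y i j)) := by
  have hnH : 0 < n * H := by positivity
  have hD₂0 : 0 < D₂ := by rw [hD₂]; positivity
  have hH₂0 : 0 < H₂ := by rw [hH₂]; positivity
  have hf1 : Fits S D₂ (2 * H₂) := hf.left hD₂0
  have hf2 : Fits S (D ^ n) ((n * H) ^ n) := by
    rw [← hD₂, ← hH₂]; exact hf1.mono_right (by omega)
  have hlen : (List.finRange n).length = n := by simp
  have hdet := idet_within hM hD hH hn hf2 hA (List.finRange n) (List.finRange n) hlen.le rfl
  rw [hlen, ← hD₂, ← hH₂] at hdet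
  set T := 12 * M (4 * S) * (n * n.factorial) with hT
  have hminor : ∀ i j : Fin n,
      Within (idet M A ((List.finRange n).erase j) ((List.finRange n).erase i)) T
        (IRep D₂ H₂) := fun i j => by
    have he : ∀ i : Fin n, ((List.finRange n).erase i).length = n - 1 := fun i => by
      rw [List.length_erase_of_mem (List.mem_finRange i), hlen]
    have := idet_within hM hD hH hn hf2 hA ((List.finRange n).erase j) ((List.finRange n).erase i)
      (by rw [he]; omega) (by rw [he, he])
    rw [he] at this
    refine (this.imp fun v hv => hv.mono hD₂0 ?_ ?_).le ?_
    · rw [hD₂]; exact pow_dvd_pow _ (by omega)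
    · rw [hH₂]; exact Nat.pow_le_pow_right hnH (by omega)
    · have : (n - 1).factorial ≤ n.factorial := Nat.factorial_le (by omega)
      have h1 : n - 1 ≤ n := by omega
      rw [hT]
      gcongr
  refine (hdet.bind fun d hd => (isign_within hM hd (hf1.mono_right (by omega))).bind fun s _ =>
    Within.ite (a := n * (n * (T + 14 * M (4 * S)))) (fun _ => ?_) (fun _ => ?_)).le ?_
  · exact Within.le (Within.pure fun Y hY => by simp at hY) (Nat.zero_le _)
  · set E := D₂ * (d.hi⁻¹.den * d.lo⁻¹.den) with hE
    refine ((Within.tabulate (P := fun _ X => ∀ j, IRep E (2 * H₂ * D₂) (X j))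
      fun i => Within.tabulate (a := T + 14 * M (4 * S))
        (P := fun _ I => IRep E (2 * H₂ * D₂) I) fun j => ?_).bind
      fun X hX => Within.pure ?_).le (by omega)
    · have hdiv : ∀ c', IRep D₂ (2 * H₂) c' →
          Within (idiv M c' d) (12 * M (4 * S)) (IRep E (2 * H₂ * D₂)) := fun c' hc' =>
        idiv_within hM hc' hd (by positivity) hD₂0 hH₂0 (hf1.mono_right (by omega)) hf
      refine Within.le (a := T + (2 * M (4 * S) + 12 * M (4 * S))) ?_ (by omega)
      refine (hminor i j).bind fun c hc => Within.ite (fun _ => ?_) (fun _ => ?_)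
      · exact (((Within.pure (hc.mono_right (by omega))).le (Nat.zero_le _))).bind hdiv
      · have := isub_within hM (S := S) (IRep.pt (Rep.zero (D := D₂) (H := H₂))) hc
          (hf1.mono_right (by omega))
        rw [← two_mul H₂] at this
        exact this.bind hdiv
    · rintro Y hY
      obtain rfl := Option.some.inj hY
      have p1 := d.lo⁻¹.den_pos
      have p2 := d.hi⁻¹.den_pos
      refine ⟨E, by positivity, ?_, hX⟩
      exact Nat.mul_le_mul_left _ (Nat.mul_le_mul (hd.2.den_inv_le hD₂0 hH₂0)
        (hd.1.den_inv_le hD₂0 hH₂0))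
  · rw [add_mul, ← mul_assoc n n]
    omega

end Poly

/-! ### Dyadic boxes and their bisection -/

/-- A side of a box after `j` bisections: it has length `2 / 2 ^ j`, and its endpoints are
multiples of `1 / 2 ^ j` in `[-1, 1]`. -/
def Side (K j : ℕ) (I : IV) : Prop := j ≤ K ∧ IRep (2 ^ j) 1 I ∧ I.hi - I.lo = 2 / 2 ^ j

/-- A factor of a face of a box: a side, or a point that is an endpoint of a side. -/
def FaceSide (K : ℕ) (I : IV) : Prop := (∃ j, Side K j I) ∨ ∃ q, Rep (2 ^ K) 1 q ∧ I = IV.pt q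

/-- A face of dimension `k` of a box with sides as above. -/
def DyadicFace {n : ℕ} (K k : ℕ) (B : Face n) : Prop :=
  B.free.length = k ∧ ∀ i, FaceSide K (B.box i)

theorem Side.iRep {K j : ℕ} {I : IV} (h : Side K j I) : IRep (2 ^ K) 1 I :=
  h.2.1.mono (by positivity) (pow_dvd_pow _ h.1) le_rfl

namespace FaceSide

variable {K : ℕ} {I : IV}

theorem iRep (h : FaceSide K I) : IRep (2 ^ K) 1 I := by
  rcases h with ⟨j, h⟩ | ⟨q, h, rfl⟩
  · exact h.iRep
  · exact IRep.pt h

theorem lo (h : FaceSide K I) : FaceSide K (IV.pt I.lo) := Or.inr ⟨_, h.iRep.1, rfl⟩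

theorem hi (h : FaceSide K I) : FaceSide K (IV.pt I.hi) := Or.inr ⟨_, h.iRep.2, rfl⟩

end FaceSide

theorem forall_update {n : ℕ} {P : IV → Prop} {B : Box n} {I : IV} {i : Fin n}
    (hB : ∀ j, P (B j)) (hI : P I) : ∀ j, P (Function.update B i I j) := by
  intro j
  rcases eq_or_ne j i with rfl | h
  · simpa using hI
  · simpa [h] using hB j

theorem Rep.half {k : ℕ} {x : ℚ} (h : Rep (2 ^ k) 2 x) : Rep (2 ^ (k + 1)) 1 (x / 2) := by
  obtain ⟨⟨z, hz⟩, hs⟩ := h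
  refine ⟨⟨z, by rw [hz, pow_succ]; push_cast; rw [div_div]⟩, ?_⟩
  rw [abs_div, abs_two, div_le_iff₀ two_pos]
  push_cast at hs ⊢
  linarith

theorem Side.mid {K j : ℕ} {I : IV} (h : Side K j I) (hj : j < K) :
    Side K (j + 1) ⟨I.lo, (I.lo + I.hi) / 2⟩ ∧ Side K (j + 1) ⟨(I.lo + I.hi) / 2, I.hi⟩ := by
  obtain ⟨-, hI, hw⟩ := h
  have hm : Rep (2 ^ (j + 1)) 1 ((I.lo + I.hi) / 2) := (hI.1.add hI.2).half
  have hI' : IRep (2 ^ (j + 1)) 1 I := hI.mono (by positivity) (pow_dvd_pow _ (by omega)) le_rfl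
  have h2 : (2 : ℚ) / 2 ^ (j + 1) = (2 / 2 ^ j) / 2 := by rw [pow_succ, div_div]
  refine ⟨⟨hj, ⟨hI'.1, hm⟩, ?_⟩, ⟨hj, ⟨hm, hI'.2⟩, ?_⟩⟩ <;> simp only [h2, ← hw] <;> ring

section Geometry

variable {M : ℕ → ℕ} {S n K : ℕ}

theorem bisect_within (hM : IsArithCost M) (hS : Fits S (2 ^ K) 2) {B : Box n} {i : Fin n} {j : ℕ}
    (h : Side K j (B i)) (hj : j < K) :
    Within (bisect M B i) (2 * M (4 * S)) (fun H => ∃ I J, H.1 = Function.update B i I ∧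
      H.2 = Function.update B i J ∧ Side K (j + 1) I ∧ Side K (j + 1) J) := by
  have hI := h.iRep
  have h1 : Fits S (2 ^ K) 1 := hS.mono_right (by omega)
  have hs : Rep (2 ^ K) 2 ((B i).lo + (B i).hi) := hI.1.add hI.2
  have htwo : Rep 1 2 2 := ⟨⟨2, by simp⟩, by norm_num⟩
  refine ((qop_within hM hI.1 hI.2 h1 h1).bind fun s hs' =>
    (qop_within hM (hs' ▸ hs) htwo hS (hS.mono one_pos Nat.one_le_two_pow le_rfl)).bind
      fun c hc => Within.pure ?_).le (by omega)
  subst hs'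
  subst hc
  exact ⟨_, _, rfl, rfl, h.mid hj⟩

theorem widest_within (hM : IsArithCost M) (hS : Fits S (2 ^ K) 2) {B : Face n}
    (hB : ∀ i, IRep (2 ^ K) 1 (B.box i)) :
    Within (widest M B) (B.free.length * (2 * M (4 * S)))
      (fun w : Option (Fin n) × ℚ => Rep (2 ^ K) 2 w.2 ∧
      ∀ i, w.1 = some i → i ∈ B.free ∧ w.2 = (B.box i).hi - (B.box i).lo) := by
  have h1 : Fits S (2 ^ K) 1 := hS.mono_right (by omega)
  refine Within.foldlM (l := B.free) (fun _ (w : Option (Fin n) × ℚ) => Rep (2 ^ K) 2 w.2 ∧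
      ∀ i, w.1 = some i → i ∈ B.free ∧ w.2 = (B.box i).hi - (B.box i).lo)
    ⟨Rep.zero, by simp⟩ fun _ acc i hi _ hacc => ?_
  have hw : Rep (2 ^ K) 2 ((B.box i).hi - (B.box i).lo) := (hB i).2.sub (hB i).1
  refine ((qop_within hM (hB i).2 (hB i).1 h1 h1).bind fun w hw' =>
    (qop_within hM hacc.1 (hw' ▸ hw) hS hS).bind fun b _ => Within.pure ?_).le (by omega)
  subst hw'
  split
  · refine ⟨hw, fun j hj => ?_⟩
    obtain rfl := Option.some.inj hj
    exact ⟨hi, rfl⟩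
  · exact hacc

theorem exceeds_within (hM : IsArithCost M) (hS : Fits S (2 ^ K) 2) {ρ w : ℚ}
    (hw : Rep (2 ^ K) 2 w) : Within (exceeds M ρ w) (M (4 * S)) (· = decide (ρ < w)) :=
  ⟨rfl, hM.mono (by have := hw.bitSize_le hS; omega)⟩

/-- A side that is wider than the precision may be bisected once more. -/
theorem Side.lt {ρ : ℚ} (hK : 2 / 2 ^ K ≤ ρ) {j : ℕ} {I : IV} (h : Side K j I)
    (hρ : ρ < I.hi - I.lo) : j < K := by
  rw [h.2.2] at hρ
  have h1 : (2 : ℚ) / 2 ^ K < 2 / 2 ^ j := hK.trans_lt hρ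
  rw [div_lt_div_iff_of_pos_left two_pos (by positivity) (by positivity)] at h1
  exact (pow_lt_pow_iff_right₀ (by norm_num)).1 h1

theorem FaceSide.exists_side {ρ : ℚ} (h0 : 0 < ρ) {I : IV} (h : FaceSide K I)
    (hρ : ρ < I.hi - I.lo) : ∃ j, Side K j I := by
  rcases h with h | ⟨q, -, rfl⟩
  · exact h
  · simp only [IV.pt, sub_self] at hρ
    exact absurd hρ (not_lt.2 h0.le)

theorem vertices_spec : ∀ (l : List (Fin n)) (B : Box n), (∀ i, FaceSide K (B i)) →
    (vertices l B).length = 2 ^ l.length ∧ ∀ v ∈ vertices l B, ∀ i, FaceSide K (v i)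
  | [], B, hB => by simpa [vertices] using hB
  | i :: l, B, hB => by
    have h1 := vertices_spec l _ (forall_update (i := i) hB (hB i).lo)
    have h2 := vertices_spec l _ (forall_update (i := i) hB (hB i).hi)
    refine ⟨?_, fun v hv => ?_⟩
    · simp only [vertices, List.length_append, h1.1, h2.1, List.length_cons, pow_succ]
      ring
    · rcases List.mem_append.1 hv with hv | hv
      · exact h1.2 v hv
      · exact h2.2 v hv

theorem DyadicFace.facets {k : ℕ} {B : Face n} (hB : DyadicFace K (k + 1) B) :
    B.facets.length = 2 * (k + 1) ∧ ∀ P ∈ B.facets, DyadicFace K k P := by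
  constructor
  · rw [← hB.1]
    simp [Face.facets, List.length_flatMap, mul_comm]
  · intro P hP
    obtain ⟨i, hi, hP⟩ := List.mem_flatMap.1 hP
    have hlen : (B.free.erase i).length = k := by
      rw [List.length_erase_of_mem hi, hB.1]; rfl
    rcases List.mem_cons.1 hP with rfl | hP
    · exact ⟨hlen, forall_update hB.2 (hB.2 i).lo⟩
    · obtain rfl := List.mem_singleton.1 hP
      exact ⟨hlen, forall_update hB.2 (hB.2 i).hi⟩

/-! ### The cost of the existence test -/

variable {g : Box n → Timed IV} {E : Face n → Timed Verdict} {G T k : ℕ} {ρ : ℚ}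

theorem vertexSign_within (hM : IsArithCost M)
    (hg : ∀ B : Box n, (∀ i, FaceSide K (B i)) →
      Within (g B) G (fun I => ∃ D H, Fits S D H ∧ IRep D H I))
    {B : Face n} (hB : DyadicFace K k B) :
    Within (vertexSign M g B) (2 ^ k * (G + 2 * M (4 * S))) (fun _ => True) := by
  obtain ⟨hlen, hv⟩ := vertices_spec B.free B.box hB.2
  rw [hB.1] at hlen
  rw [← hlen]
  refine ((Within.foldlM (l := vertices B.free B.box) (T := G + 2 * M (4 * S))
    (fun _ _ => True) trivial fun _ s v hvm _ _ => ?_).bind fun _ _ => Within.pure trivial)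
  exact (hg v (hv v hvm)).bind fun I ⟨D, H, hf, hI⟩ => (isign_within hM hI hf).bind
    fun _ _ => Within.pure trivial

theorem refine_within (hM : IsArithCost M) (hS : Fits S (2 ^ K) 2)
    (hE : ∀ P, DyadicFace K k P → Within (E P) T (fun _ => True))
    {B : Face n} (hB : DyadicFace K k B) {i : Fin n} {j : ℕ} (hj : Side K j (B.box i))
    (hjK : j < K) :
    Within (refine M E B i) (2 * M (4 * S) + (T + T))
      (fun o => ∀ P, o = some P → DyadicFace K k P) := by
  refine (bisect_within hM hS hj hjK).bind fun H hH => ?_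
  obtain ⟨I, J, h1, h2, hI, hJ⟩ := hH
  have g1 : DyadicFace K k ⟨H.1, B.free⟩ :=
    ⟨hB.1, by simp only [h1]; exact forall_update hB.2 (Or.inl ⟨_, hI⟩)⟩
  have g2 : DyadicFace K k ⟨H.2, B.free⟩ :=
    ⟨hB.1, by simp only [h2]; exact forall_update hB.2 (Or.inl ⟨_, hJ⟩)⟩
  refine (hE _ g1).bind fun a _ => ?_
  split
  · refine (Within.pure fun P hP => ?_).le (Nat.zero_le _)
    obtain rfl := Option.some.inj hP
    exact g1
  · refine Within.le (a := T + 0) ((hE _ g2).bind fun b _ => ?_) le_rfl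
    split
    · refine Within.pure fun P hP => ?_
      obtain rfl := Option.some.inj hP
      exact g2
    · exact Within.pure fun P hP => by simp at hP

theorem refineLoop_within (hM : IsArithCost M) (hS : Fits S (2 ^ K) 2) (hρ : 0 < ρ)
    (hK : 2 / 2 ^ K ≤ ρ) (hE : ∀ P, DyadicFace K k P → Within (E P) T (fun _ => True))
    (hg : ∀ B : Box n, (∀ i, FaceSide K (B i)) →
      Within (g B) G (fun I => ∃ D H, Fits S D H ∧ IRep D H I)) :
    ∀ (r : ℕ) (B : Face n) (t : ℤ), DyadicFace K k B →
      Within (refineLoop M ρ E g r B t)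
        (r * (2 * T + (2 * k + 3) * M (4 * S) + 2 ^ k * (G + 2 * M (4 * S)))) (fun _ => True)
  | 0, B, t, _ => by simpa [refineLoop] using Within.pure trivial
  | r + 1, B, t, hB => by
    unfold refineLoop
    refine Within.ite (fun _ => Within.le (Within.pure trivial) (Nat.zero_le _)) fun _ => ?_
    have hw := widest_within hM hS (B := B) fun i => (hB.2 i).iRep
    rw [hB.1] at hw
    set X := 2 ^ k * (G + 2 * M (4 * S))
    set Y := 2 * T + (2 * k + 3) * M (4 * S) + X with hY
    refine Within.le (a := k * (2 * M (4 * S)) + (M (4 * S) + (2 * M (4 * S) + (T + T) +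
      (X + r * Y)))) ?_ (by rw [add_mul, one_mul, hY]; ring_nf; exact le_rfl)
    refine hw.bind fun w hw => (exceeds_within hM hS hw.1).bind fun b hb => ?_
    subst hb
    split
    · rename_i i hbig hi
      have hbig := of_decide_eq_true hbig
      rw [(hw.2 i hi).2] at hbig
      obtain ⟨j, hj⟩ := (hB.2 i).exists_side hρ hbig
      refine (refine_within hM hS hE hB hj (hj.lt hK hbig)).bind fun B' hB' => ?_
      split
      · exact Within.le (Within.pure trivial) (Nat.zero_le _)
      · rename_i P
        have hP := hB' P rfl
        exact (vertexSign_within hM hg hP).bind fun t' _ =>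
          refineLoop_within hM hS hρ hK hE hg r P t' hP
    · exact Within.le (Within.pure trivial) (Nat.zero_le _)

theorem findTwo_within (hE : ∀ P, DyadicFace K k P → Within (E P) T (fun _ => True)) :
    ∀ (l s : List (Face n)), (∀ P ∈ l, DyadicFace K k P) → (∀ P ∈ s, DyadicFace K k P) →
      Within (findTwo E l s) (l.length * T) (fun o => ∀ u, o = some u → ∀ P ∈ u, DyadicFace K k P)
  | [], s, _, hs => by
    refine Within.le (Within.pure fun u hu => ?_) (Nat.zero_le _)
    obtain rfl := Option.some.inj hu
    exact hs
  | B :: l, s, hl, hs => by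
    unfold findTwo
    refine Within.ite (fun _ => ?_) fun _ => ?_
    · refine Within.le (Within.pure fun u hu => ?_) (Nat.zero_le _)
      obtain rfl := Option.some.inj hu
      exact hs
    · rw [List.length_cons, add_mul, one_mul, add_comm]
      have hB := hl B (by simp)
      have hl' : ∀ P ∈ l, DyadicFace K k P := fun P hP => hl P (by simp [hP])
      refine (hE B hB).bind fun b _ => ?_
      split
      · exact Within.le (Within.pure fun u hu => by simp at hu) (Nat.zero_le _)
      · exact findTwo_within hE l s hl' hs
      · refine findTwo_within hE l _ hl' fun P hP => ?_
        rcases List.mem_append.1 hP with hP | hP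
        · exact hs P hP
        · obtain rfl := List.mem_singleton.1 hP
          exact hB

theorem existenceStep_within (hM : IsArithCost M) (hS : Fits S (2 ^ K) 2) (hρ : 0 < ρ)
    (hK : 2 / 2 ^ K ≤ ρ) (r : ℕ) (hE : ∀ P, DyadicFace K k P → Within (E P) T (fun _ => True))
    (hg : ∀ B : Box n, (∀ i, FaceSide K (B i)) →
      Within (g B) G (fun I => ∃ D H, Fits S D H ∧ IRep D H I))
    {B : Face n} (hB : DyadicFace K (k + 1) B) :
    Within (existenceStep M r ρ E g B) (2 * (k + 1) * T + 2 * (2 ^ k * (G + 2 * M (4 * S)) +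
      r * (2 * T + (2 * k + 3) * M (4 * S) + 2 ^ k * (G + 2 * M (4 * S))))) (fun _ => True) := by
  obtain ⟨hlen, hf⟩ := hB.facets
  have h2 := findTwo_within hE B.facets [] hf (by simp)
  rw [hlen] at h2
  refine h2.bind fun o ho => ?_
  split
  · exact Within.le (Within.pure trivial) (Nat.zero_le _)
  · exact Within.le (Within.pure trivial) (Nat.zero_le _)
  · rename_i B₁ B₂
    have g1 := ho _ rfl B₁ (by simp)
    have g2 := ho _ rfl B₂ (by simp)
    set X := 2 ^ k * (G + 2 * M (4 * S))
    set Y := r * (2 * T + (2 * k + 3) * M (4 * S) + X) with hY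
    refine Within.le (a := X + (Y + (X + (Y + 0)))) ?_ (by omega)
    refine (vertexSign_within hM hg g1).bind fun s₁ _ =>
      (refineLoop_within hM hS hρ hK hE hg r B₁ s₁ g1).bind fun t₁ _ =>
      (vertexSign_within hM hg g2).bind fun s₂ _ =>
      (refineLoop_within hM hS hρ hK hE hg r B₂ s₂ g2).bind fun t₂ _ => ?_
    exact Within.ite (fun _ => Within.pure trivial) fun _ =>
      Within.ite (fun _ => Within.pure trivial) fun _ => Within.pure trivial
  · exact Within.le (Within.pure trivial) (Nat.zero_le _)

/-- The existence test in dimension `k` calls the test in dimension `k - 1` at most `2 k` times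
for the facets and at most `4 r` times for refinements; this gives the factor
`2 ^ k * (k + 2 r)!`. The evaluations at vertices are absorbed by it up to the factor `k`. -/
theorem existence_within (hM : IsArithCost M) (hS : Fits S (2 ^ K) 2) (hρ : 0 < ρ)
    (hK : 2 / 2 ^ K ≤ ρ) (r : ℕ) {g : ℕ → Box n → Timed IV}
    (hg : ∀ k, ∀ B : Box n, (∀ i, FaceSide K (B i)) →
      Within (g k B) G (fun I => ∃ D H, Fits S D H ∧ IRep D H I)) :
    ∀ (k : ℕ) (B : Face n), DyadicFace K k B →
      Within (existence M r ρ g k B)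
        (2 ^ k * (k * ((k + 2 * r).factorial * ((r + 1) * (G + 5 * M (4 * S))))))
        (fun _ => True)
  | 0, B, _ => Within.le (Within.pure trivial) (Nat.zero_le _)
  | k + 1, B, hB => by
    unfold existence
    refine (existenceStep_within hM hS hρ hK r
      (fun P hP => existence_within hM hS hρ hK r hg k P hP) (hg k) hB).le ?_
    set U := M (4 * S)
    set Z := (r + 1) * (G + 5 * U) with hZ
    set N := (k + 2 * r).factorial with hN
    set T := 2 ^ k * (k * (N * Z)) with hT
    have hfac : (k + 1 + 2 * r).factorial = (k + 1 + 2 * r) * N := by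
      rw [show k + 1 + 2 * r = (k + 2 * r) + 1 by ring, Nat.factorial_succ]
    have hpow : k + 1 ≤ 2 ^ k := Nat.lt_two_pow_self
    have h1 : 2 ^ k * (G + 2 * U) + (2 * k + 3) * U ≤ 2 ^ k * (G + 5 * U) := by
      have : (2 * k + 3) * U ≤ 2 ^ k * 3 * U := Nat.mul_le_mul_right _ (by omega)
      calc _ ≤ 2 ^ k * (G + 2 * U) + 2 ^ k * 3 * U := by omega
        _ = _ := by ring
    have h2 : 1 ≤ (k + 1 + 2 * r).factorial := Nat.factorial_pos _
    calc 2 * (k + 1) * T + 2 * (2 ^ k * (G + 2 * U) +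
          r * (2 * T + (2 * k + 3) * U + 2 ^ k * (G + 2 * U)))
        = 2 * (k + 1 + 2 * r) * T + 2 * (2 ^ k * (G + 2 * U) +
          r * (2 ^ k * (G + 2 * U) + (2 * k + 3) * U)) := by ring
      _ ≤ 2 * (k + 1 + 2 * r) * T + 2 * (2 ^ k * (G + 5 * U) + r * (2 ^ k * (G + 5 * U))) := by
          gcongr
          · omega
      _ = 2 ^ (k + 1) * (k * ((k + 1 + 2 * r).factorial * Z) + 1 * Z) := by
          rw [hT, hfac, hZ, pow_succ]; ring
      _ ≤ 2 ^ (k + 1) * (k * ((k + 1 + 2 * r).factorial * Z) +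
          (k + 1 + 2 * r).factorial * Z) := by gcongr
      _ = _ := by ring

end Geometry

/-! ### The cost of the loop body -/

/-- Bounds for the numbers that occur in the algorithm. All of them fit into `S` in the sense of
`Fits`, where `Dᵢ` and `Hᵢ` bound denominators and absolute values of: the values of the
polynomials (`i = 1`), the minors of the Jacobian matrix at a middle point (`2`), its inverse
(`3`), the preconditioner `W` (`4`), the preconditioned system and its Jacobian matrix (`5`).
The polynomials have degree at most `d`, coefficients bounded by `C` and at most `N` terms; the
matrix `V` has the common denominator `Q` and entries bounded by `H₀`. Points of evaluation have
the denominator `2 ^ (K + 1)`, where `2 ^ K` suffices for vertices of boxes and the additional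
factor for middle points. -/
structure Budget (n : ℕ) where
  (S K d C N Q H₀ D₁ H₁ D₂ H₂ D₃ H₃ D₄ H₄ D₅ H₅ : ℕ)
  n_pos : 0 < n
  d_pos : 0 < d
  C_pos : 0 < C
  N_pos : 0 < N
  Q_pos : 0 < Q
  H₀_pos : 0 < H₀
  D₁_eq : D₁ = 2 ^ ((K + 1) * d)
  H₁_eq : H₁ = N * C
  D₂_eq : D₂ = D₁ ^ n
  H₂_eq : H₂ = (n * H₁) ^ n
  D₃_eq : D₃ = D₂ * ((D₂ * H₂) * (D₂ * H₂))
  H₃_eq : H₃ = 2 * H₂ * D₂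
  D₄_eq : D₄ = Q * D₃
  H₄_eq : H₄ = n * (H₀ * H₃)
  D₅_eq : D₅ = D₄ * D₁
  H₅_eq : H₅ = n * (H₄ * H₁)
  fits : Fits S (D₅ ^ n) ((n * H₅) ^ n)
  two_mul_le : 2 * ((K + 1) * d) ≤ S

/-- A polynomial whose terms are bounded as in `TermsBound`, and which has at most `m` terms. -/
def PolyBound {n : ℕ} (b : Budget n) (m : ℕ) (p : Terms n) : Prop :=
  TermsBound b.d b.C p ∧ p.length ≤ b.N ∧ p.length ≤ m

namespace Budget

variable {n : ℕ} (b : Budget n)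

theorem pos : 0 < b.D₁ ∧ 0 < b.H₁ ∧ 0 < b.D₂ ∧ 0 < b.H₂ ∧ 0 < b.D₃ ∧ 0 < b.H₃ ∧ 0 < b.D₄ ∧
    0 < b.H₄ ∧ 0 < b.D₅ ∧ 0 < b.H₅ := by
  have hn := b.n_pos
  have h1 : 0 < b.D₁ := by rw [b.D₁_eq]; positivity
  have h2 : 0 < b.H₁ := by rw [b.H₁_eq]; exact Nat.mul_pos b.N_pos b.C_pos
  have h3 : 0 < b.D₂ := by rw [b.D₂_eq]; positivity
  have h4 : 0 < b.H₂ := by rw [b.H₂_eq]; positivity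
  have h5 : 0 < b.D₃ := by rw [b.D₃_eq]; positivity
  have h6 : 0 < b.H₃ := by rw [b.H₃_eq]; positivity
  have h7 : 0 < b.D₄ := by rw [b.D₄_eq]; exact Nat.mul_pos b.Q_pos h5
  have h8 : 0 < b.H₄ := by rw [b.H₄_eq]; exact Nat.mul_pos hn (Nat.mul_pos b.H₀_pos h6)
  have h9 : 0 < b.D₅ := by rw [b.D₅_eq]; positivity
  have h10 : 0 < b.H₅ := by rw [b.H₅_eq]; positivity
  exact ⟨h1, h2, h3, h4, h5, h6, h7, h8, h9, h10⟩

theorem fits₅ : Fits b.S b.D₅ b.H₅ := by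
  obtain ⟨-, -, -, -, -, -, -, -, h9, h10⟩ := b.pos
  refine b.fits.mono h9 (Nat.le_self_pow b.n_pos.ne' _) ?_
  exact (Nat.le_mul_of_pos_left _ b.n_pos).trans (Nat.le_self_pow b.n_pos.ne' _)

theorem fits₄ : Fits b.S b.D₄ b.H₄ := by
  obtain ⟨h1, h2, -, -, -, -, -, h8, -, -⟩ := b.pos
  have h := b.fits₅
  rw [b.D₅_eq, b.H₅_eq] at h
  exact (h.mono_right (Nat.le_mul_of_pos_left _ b.n_pos)).left h2

theorem fits₃ : Fits b.S b.D₃ b.H₃ := by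
  have h := b.fits₄
  rw [b.D₄_eq, b.H₄_eq] at h
  exact (h.mono_right (Nat.le_mul_of_pos_left _ b.n_pos)).right b.H₀_pos

theorem fits₂ : Fits b.S b.D₂ b.H₂ := by
  obtain ⟨-, -, h3, h4, -⟩ := b.pos
  have h := b.fits₃
  rw [b.D₃_eq, b.H₃_eq] at h
  exact (h.left h3).mono_right (by omega)

theorem fits₁ : Fits b.S b.D₁ b.H₁ := by
  obtain ⟨h1, h2, -⟩ := b.pos
  have h := b.fits₂
  rw [b.D₂_eq, b.H₂_eq] at h
  refine h.mono h1 (Nat.le_self_pow b.n_pos.ne' _) ?_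
  exact (Nat.le_mul_of_pos_left _ b.n_pos).trans (Nat.le_self_pow b.n_pos.ne' _)

theorem fits_side : Fits b.S (2 ^ b.K) 2 := by
  obtain ⟨-, -, h3, h4, -, h6, -⟩ := b.pos
  have h := b.fits₃.mono_right (H' := 2) (by
    rw [b.H₃_eq, mul_assoc]; exact Nat.le_mul_of_pos_right _ (by positivity))
  refine h.mono (by positivity) (le_trans ?_ (?_ : b.D₂ ≤ _)) le_rfl
  · rw [b.D₂_eq, b.D₁_eq]
    refine le_trans ?_ (Nat.le_self_pow b.n_pos.ne' _)
    exact Nat.pow_le_pow_right two_pos ((Nat.le_succ _).trans (Nat.le_mul_of_pos_right _ b.d_pos))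
  · rw [b.D₃_eq]; exact Nat.le_mul_of_pos_right _ (by positivity)

end Budget

section Body

variable {M : ℕ → ℕ} {n : ℕ} {b : Budget n} {m : ℕ}

theorem IRep.double {K : ℕ} {I : IV} (h : IRep (2 ^ K) 1 I) : IRep (2 ^ (K + 1)) 1 I :=
  h.mono (by positivity) (pow_dvd_pow _ (by omega)) le_rfl

theorem PolyBound.evalPoly_within (hM : IsArithCost M) {p : Terms n} (hp : PolyBound b m p)
    {B : Box n} (hB : ∀ j, IRep (2 ^ (b.K + 1)) 1 (B j)) :
    Within (evalPoly M p B) (52 * m * n * M (4 * b.S)) (IRep b.D₁ b.H₁) := by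
  have hf := b.fits₁
  rw [b.D₁_eq, b.H₁_eq] at hf ⊢
  refine (RootIsolation.evalPoly_within hM (by omega) b.C_pos b.N_pos b.two_mul_le hf hp.1 hp.2.1
    hB).le ?_
  have hn := b.n_pos
  calc p.length * (n * (50 * M (4 * b.S)) + 2 * M (4 * b.S))
      ≤ m * (n * (50 * M (4 * b.S)) + n * (2 * M (4 * b.S))) := by
        exact Nat.mul_le_mul hp.2.2 (Nat.add_le_add_left (Nat.le_mul_of_pos_left _ hn) _)
    _ = _ := by ring

theorem evalJac_within (hM : IsArithCost M) {J : Fin n → Fin n → Terms n}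
    (hJ : ∀ i j, PolyBound b m (J i j)) {B : Box n} (hB : ∀ j, IRep (2 ^ (b.K + 1)) 1 (B j)) :
    Within (evalJac M J B) (n * (n * (52 * m * n * M (4 * b.S))))
      (fun A => ∀ i j, IRep b.D₁ b.H₁ (A i j)) :=
  Within.tabulate fun i => Within.tabulate fun j => (hJ i j).evalPoly_within hM hB

theorem middle_within (hM : IsArithCost M) {B : Box n} (hB : ∀ j, IRep (2 ^ b.K) 1 (B j)) :
    Within (middle M B) (n * (2 * M (4 * b.S)))
      (fun P => ∀ j, IRep (2 ^ (b.K + 1)) 1 (P j)) := by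
  have h2 := b.fits_side
  have h1 : Fits b.S (2 ^ b.K) 1 := h2.mono_right (by omega)
  have htwo : Rep 1 2 2 := ⟨⟨2, by simp⟩, by norm_num⟩
  refine Within.tabulate (P := fun _ => IRep (2 ^ (b.K + 1)) 1) fun i => ?_
  have hs : Rep (2 ^ b.K) 2 ((B i).lo + (B i).hi) := (hB i).1.add (hB i).2
  refine ((qop_within hM (hB i).1 (hB i).2 h1 h1).bind fun s hs' =>
    (qop_within hM (hs' ▸ hs) htwo h2 (h2.mono one_pos Nat.one_le_two_pow le_rfl)).bind
      fun c hc => Within.pure (IRep.pt ?_)).le (by omega)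
  subst hs' hc
  exact hs.half

theorem exclusion_within (hM : IsArithCost M) {F : Fin n → Terms n}
    (hF : ∀ i, PolyBound b m (F i)) {B : Box n} (hB : ∀ j, IRep (2 ^ (b.K + 1)) 1 (B j)) :
    Within (exclusion M F B) (n * (52 * m * n * M (4 * b.S) + 2 * M (4 * b.S)))
      (fun _ => True) := by
  have := Within.foldlM (l := List.finRange n) (f := fun out i => do
      let I ← evalPoly M (F i) B
      let s ← isign M I
      return out || decide (s ≠ 0)) (T := 52 * m * n * M (4 * b.S) + 2 * M (4 * b.S))
    (fun _ _ => True) (v := false) trivial fun _ out i _ _ _ =>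
      ((hF i).evalPoly_within hM hB).bind fun I hI => (isign_within hM hI b.fits₁).bind
        fun _ _ => Within.pure trivial
  rwa [List.length_finRange] at this

theorem precond_within (hM : IsArithCost M) {V : Matrix (Fin n) (Fin n) ℚ}
    (hV : ∀ i j, Rep b.Q b.H₀ (V i j)) {J : Fin n → Fin n → Terms n}
    (hJ : ∀ i j, PolyBound b m (J i j)) {B : Box n} (hB : ∀ j, IRep (2 ^ b.K) 1 (B j)) :
    Within (precond M V J B) (n * (2 * M (4 * b.S)) + n * (n * (52 * m * n * M (4 * b.S))) +
        (n * n + 1) * (12 * M (4 * b.S) * (n * n.factorial) + 14 * M (4 * b.S)) +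
        n * (n * (n * (12 * M (4 * b.S)))))
      (fun o => ∀ W, o = some W → ∃ E, 0 < E ∧ E ≤ b.D₄ ∧ ∀ i j, IRep E b.H₄ (W i j)) := by
  obtain ⟨h1, h2, -, -, h5, h6, -⟩ := b.pos
  have hf := b.fits₃
  rw [b.D₃_eq, b.H₃_eq] at hf
  unfold precond
  rw [add_assoc, add_assoc]
  refine (middle_within hM hB).bind fun P hP => (evalJac_within hM hJ hP).bind fun A hA =>
    (inverse_within hM h1 h2 b.n_pos b.D₂_eq b.H₂_eq hf hA).bind fun X hX => ?_
  rw [← b.D₃_eq, ← b.H₃_eq] at hX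
  split
  · exact Within.le (Within.pure fun W hW => by simp at hW) (Nat.zero_le _)
  · rename_i X
    obtain ⟨E, hE0, hE, hX⟩ := hX X rfl
    have hle : b.Q * E ≤ b.D₄ := by rw [b.D₄_eq]; exact Nat.mul_le_mul_left _ hE
    have hQE : 0 < b.Q * E := Nat.mul_pos b.Q_pos hE0
    refine (matMul_within (D := b.Q) (H := b.H₀) hM b.H₀_pos h6 b.n_pos
      (b.fits₄.mono hQE hle ?_) (fun i j => IRep.pt (hV i j)) hX).bind
        fun W hW => Within.pure ?_
    · rw [b.H₄_eq]
    · rintro W' hW'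
      obtain rfl := Option.some.inj hW'
      exact ⟨b.Q * E, hQE, hle, by rw [b.H₄_eq]; exact hW⟩

theorem evalComb_within (hM : IsArithCost M) {F : Fin n → Terms n}
    (hF : ∀ i, PolyBound b m (F i)) {E : ℕ} (hE : 0 < E) (hE' : E ≤ b.D₄) {w : Fin n → IV}
    (hw : ∀ j, IRep E b.H₄ (w j)) {B : Box n} (hB : ∀ j, IRep (2 ^ (b.K + 1)) 1 (B j)) :
    Within (evalComb M F w B) (n * (52 * m * n * M (4 * b.S)) + n * (12 * M (4 * b.S)))
      (fun I => ∃ D H, Fits b.S D H ∧ IRep D H I) := by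
  obtain ⟨h1, h2, -, -, -, -, -, h8, -⟩ := b.pos
  have hf : Fits b.S (E * b.D₁) (n * (b.H₄ * b.H₁)) :=
    b.fits₅.mono (by positivity) (by rw [b.D₅_eq]; exact Nat.mul_le_mul_right _ hE')
      (by rw [b.H₅_eq])
  refine (Within.tabulate (P := fun _ => IRep b.D₁ b.H₁)
    fun j => (hF j).evalPoly_within hM hB).bind fun y hy => ?_
  exact (dot_within hM h8 h2 b.n_pos hf hw hy).imp fun I hI => ⟨_, _, hf, hI⟩

/-- The outcome `o` for the box `B` is not a split, or a split that halves one of the sides of `B`. -/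
def SplitsInto (K : ℕ) (B : Box n) (o : Outcome n) : Prop :=
  ∀ B₁ B₂, o = .split B₁ B₂ → ∀ j : Fin n → ℕ, (∀ i, Side K (j i) (B i)) →
    ∃ i I J, B₁ = Function.update B i I ∧ B₂ = Function.update B i J ∧
      Side K (j i + 1) I ∧ Side K (j i + 1) J

/-- The number of bisections of a side is determined by its length. -/
theorem Side.unique {K j j' : ℕ} {I : IV} (h : Side K j I) (h' : Side K j' I) : j = j' := by
  have h1 : (2 : ℚ) / 2 ^ j = 2 / 2 ^ j' := h.2.2.symm.trans h'.2.2
  have h2 : (2 : ℚ) ^ j = 2 ^ j' := by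
    rw [div_eq_div_iff (by positivity) (by positivity)] at h1
    linarith
  exact pow_right_injective₀ (by norm_num) (by norm_num) h2

theorem splitOrSuspect_within (hM : IsArithCost M) {ρ : ℚ} (hK : 2 / 2 ^ b.K ≤ ρ) {B : Box n}
    (hB : ∀ i, ∃ j, Side b.K j (B i)) :
    Within (splitOrSuspect M ρ B) (n * (2 * M (4 * b.S)) + 3 * M (4 * b.S))
      (SplitsInto b.K B) := by
  have hw := widest_within hM b.fits_side (B := ⟨B, List.finRange n⟩)
    fun i => (hB i).choose_spec.iRep
  simp only [List.length_finRange] at hw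
  refine Within.le (a := n * (2 * M (4 * b.S)) + (M (4 * b.S) + (2 * M (4 * b.S) + 0))) ?_
    (by omega)
  refine hw.bind fun w hw => (exceeds_within hM b.fits_side hw.1).bind fun c hc => ?_
  subst hc
  split
  · rename_i i hbig hi
    have hbig := of_decide_eq_true hbig
    rw [(hw.2 i hi).2] at hbig
    obtain ⟨j, hj⟩ := hB i
    refine (bisect_within hM b.fits_side hj (hj.lt hK hbig)).bind fun H hH => Within.pure ?_
    obtain ⟨I, J, e1, e2, hI, hJ⟩ := hH
    intro B₁ B₂ hs j' hj'
    obtain ⟨rfl, rfl⟩ := Outcome.split.inj hs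
    obtain rfl := hj.unique (hj' i)
    exact ⟨i, I, J, e1, e2, hI, hJ⟩
  · exact Within.le (Within.pure fun B₁ B₂ hs => by simp at hs) (Nat.zero_le _)

theorem processBox_within (hM : IsArithCost M) (r : ℕ) {ρ : ℚ} (hρ : 0 < ρ)
    (hK : 2 / 2 ^ b.K ≤ ρ) (hm : 0 < m) {V : Matrix (Fin n) (Fin n) ℚ}
    (hV : ∀ i j, Rep b.Q b.H₀ (V i j)) {F : Fin n → Terms n} {J : Fin n → Fin n → Terms n}
    (hF : ∀ i, PolyBound b m (F i)) (hJ : ∀ i j, PolyBound b m (J i j))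
    {B : Box n} (hB : ∀ i, ∃ j, Side b.K j (B i)) :
    Within (processBox M r ρ V F J B)
      (330 * ((r + 1) * (2 ^ n * (n ^ 3 * ((n + 2 * r).factorial * (m * M (4 * b.S)))))))
      (SplitsInto b.K B) := by
  obtain ⟨h1, h2, -, -, -, -, -, h8, h9, h10⟩ := b.pos
  have hn := b.n_pos
  have hB0 : ∀ i, IRep (2 ^ b.K) 1 (B i) := fun i => (hB i).choose_spec.iRep
  have hB1 : ∀ i, IRep (2 ^ (b.K + 1)) 1 (B i) := fun i => (hB0 i).double
  set U := M (4 * b.S) with hU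
  set N := (n + 2 * r).factorial with hN
  have hs := splitOrSuspect_within (b := b) hM hK hB
  rw [← hU] at hs
  -- the costs of: exclusion, preconditioner, Jacobian matrix, its product with `W`, S-M test,
  -- existence test, bisection
  set A₁ := n * (52 * m * n * U + 2 * U) with hA₁
  set A₂ := n * (2 * U) + n * (n * (52 * m * n * U)) +
    (n * n + 1) * (12 * U * (n * n.factorial) + 14 * U) + n * (n * (n * (12 * U))) with hA₂
  set A₃ := n * (n * (52 * m * n * U)) with hA₃
  set A₄ := n * (n * (n * (12 * U))) with hA₄
  set A₅ := n * (n.factorial * (12 * U * n + 2 * U)) with hA₅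
  set A₆ := 2 ^ n * (n * (N * ((r + 1) * (n * (52 * m * n * U) + n * (12 * U) + 5 * U))))
    with hA₆
  set A₇ := n * (2 * U) + 3 * U with hA₇
  have hnone : ∀ o : Outcome n, (∀ B₁ B₂, o ≠ .split B₁ B₂) → SplitsInto b.K B o :=
    fun o ho B₁ B₂ h => absurd h (ho B₁ B₂)
  refine Within.le (a := A₁ + (A₂ + (A₃ + (A₄ + (A₅ + (A₆ + A₇)))))) ?_ ?_
  · refine (exclusion_within hM hF hB1).bind fun out _ => Within.ite (fun _ => ?_) fun _ => ?_
    · exact Within.le (Within.pure (hnone _ (by simp))) (Nat.zero_le _)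
    refine (precond_within hM hV hJ hB0).bind fun W hW => ?_
    split
    · exact hs.le (by omega)
    rename_i W
    obtain ⟨E, hE0, hE, hW⟩ := hW W rfl
    have hED : E * b.D₁ ≤ b.D₅ := by rw [b.D₅_eq]; exact Nat.mul_le_mul_right _ hE
    have hED0 : 0 < E * b.D₁ := by positivity
    refine (evalJac_within hM hJ hB1).bind fun JB hJB => (matMul_within hM h8 h2 hn
      (b.fits₅.mono hED0 hED b.H₅_eq.ge) hW hJB).bind fun JG hJG => ?_
    rw [← b.H₅_eq] at hJG
    refine (isSMTest_within hM hED0 h10 hn (b.fits.mono (by positivity)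
      (Nat.pow_le_pow_left hED _) le_rfl) hJG).bind fun sm _ =>
        Within.ite (fun _ => ?_) fun _ => hs.le (Nat.le_add_left _ _)
    refine (existence_within (K := b.K) hM b.fits_side hρ hK r (fun k P hP => ?_) n
      ⟨B, List.finRange n⟩ ⟨by simp, fun i => Or.inl (hB i)⟩).bind (b := A₇) fun v _ => ?_
    · split
      · exact evalComb_within hM hF hE0 hE (hW _) fun j => (hP j).iRep.double
      · exact Within.le (Within.pure ⟨1, 1, b.fits₁.mono one_pos h1 h2, IRep.pt Rep.zero⟩)
          (Nat.zero_le _)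
    · split
      all_goals exact Within.le (Within.pure (hnone _ (by simp))) (Nat.zero_le _)
  · have hf : n.factorial ≤ N := Nat.factorial_le (by omega)
    have hN1 : 1 ≤ N := Nat.factorial_pos _
    set X := n ^ 3 * (N * (m * U)) with hX
    have p : 1 ≤ 2 ^ n := Nat.one_le_two_pow
    have e1 : n ≤ n ^ 3 := Nat.le_self_pow (by norm_num) n
    have e2 : n ^ 2 ≤ n ^ 3 := Nat.pow_le_pow_right hn (by norm_num)
    have e0 : 1 ≤ n ^ 3 := Nat.one_le_pow _ _ hn
    have bd : ∀ a c e : ℕ, a ≤ n ^ 3 → c ≤ N → e ≤ m → a * (c * (e * U)) ≤ X :=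
      fun a c e ha hc he => by rw [hX]; gcongr
    have x1 := bd (n ^ 2) 1 m e2 hN1 le_rfl
    have x2 := bd n 1 1 e1 hN1 hm
    have x3 := bd (n ^ 3) 1 m le_rfl hN1 le_rfl
    have x4 := bd (n ^ 3) n.factorial 1 le_rfl hf hm
    have x5 := bd (n ^ 2) 1 1 e2 hN1 hm
    have x6 := bd n n.factorial 1 e1 hf hm
    have x7 := bd 1 1 1 e0 hN1 hm
    have x8 := bd (n ^ 3) 1 1 le_rfl hN1 hm
    have x9 := bd (n ^ 2) n.factorial 1 e2 hf hm
    -- every part except the existence test is at most a constant times `X`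
    have s1 : A₁ ≤ 54 * X := by
      calc A₁ = 52 * (n ^ 2 * (1 * (m * U))) + 2 * (n * (1 * (1 * U))) := by rw [hA₁]; ring
        _ ≤ _ := by omega
    have s2 : A₂ ≤ 118 * X := by
      calc A₂ = 2 * (n * (1 * (1 * U))) + 52 * (n ^ 3 * (1 * (m * U))) +
            (12 * (n ^ 3 * (n.factorial * (1 * U))) + 14 * (n ^ 2 * (1 * (1 * U))) +
              12 * (n * (n.factorial * (1 * U))) + 14 * (1 * (1 * (1 * U)))) +
              12 * (n ^ 3 * (1 * (1 * U))) := by rw [hA₂]; ring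
        _ ≤ _ := by omega
    have s3 : A₃ ≤ 52 * X := by
      calc A₃ = 52 * (n ^ 3 * (1 * (m * U))) := by rw [hA₃]; ring
        _ ≤ _ := by omega
    have s4 : A₄ ≤ 12 * X := by
      calc A₄ = 12 * (n ^ 3 * (1 * (1 * U))) := by rw [hA₄]; ring
        _ ≤ _ := by omega
    have s5 : A₅ ≤ 14 * X := by
      calc A₅ = 12 * (n ^ 2 * (n.factorial * (1 * U))) + 2 * (n * (n.factorial * (1 * U))) := by
            rw [hA₅]; ring
        _ ≤ _ := by omega
    have s7 : A₇ ≤ 5 * X := by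
      calc A₇ = 2 * (n * (1 * (1 * U))) + 3 * (1 * (1 * (1 * U))) := by rw [hA₇]; ring
        _ ≤ _ := by omega
    have s6 : A₆ ≤ 69 * ((r + 1) * (2 ^ n * X)) := by
      have y1 := bd (n ^ 3) N m le_rfl le_rfl le_rfl
      have y2 := bd (n ^ 2) N 1 e2 le_rfl hm
      have y3 := bd n N 1 e1 le_rfl hm
      calc A₆ = (r + 1) * (2 ^ n * (52 * (n ^ 3 * (N * (m * U))) + 12 * (n ^ 2 * (N * (1 * U))) +
            5 * (n * (N * (1 * U))))) := by rw [hA₆]; ring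
        _ ≤ (r + 1) * (2 ^ n * (69 * X)) := by
            gcongr
            omega
        _ = _ := by ring
    have hX' : X ≤ (r + 1) * (2 ^ n * X) :=
      (Nat.le_mul_of_pos_left _ p).trans (Nat.le_mul_of_pos_left _ (by omega))
    omega

end Body

/-! ### The number of iterations -/

section Loop

variable {M : ℕ → ℕ} {n : ℕ}

/-- The volume of a box, in units of the smallest possible box. -/
def weight (K : ℕ) (B : Box n) : ℕ := ∏ i, ⌊((B i).hi - (B i).lo) * 2 ^ K / 2⌋₊

theorem Side.floor_eq {K j : ℕ} {I : IV} (h : Side K j I) :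
    ⌊(I.hi - I.lo) * 2 ^ K / 2⌋₊ = 2 ^ (K - j) := by
  have : (I.hi - I.lo) * 2 ^ K / 2 = ((2 ^ (K - j) : ℕ) : ℚ) := by
    rw [h.2.2]
    push_cast
    rw [pow_sub₀ _ two_ne_zero h.1]
    field_simp
  rw [this, Nat.floor_natCast]

theorem weight_pos {K : ℕ} {B : Box n} (hB : ∀ i, ∃ j, Side K j (B i)) : 0 < weight K B :=
  Finset.prod_pos fun i _ => by
    obtain ⟨j, hj⟩ := hB i
    rw [hj.floor_eq]
    positivity

theorem weight_split {K j : ℕ} {B : Box n} {i : Fin n} {I J : IV} (hB : Side K j (B i))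
    (hI : Side K (j + 1) I) (hJ : Side K (j + 1) J) :
    weight K (Function.update B i I) + weight K (Function.update B i J) = weight K B := by
  have h : ∀ A : IV, weight K (Function.update B i A) = ⌊(A.hi - A.lo) * 2 ^ K / 2⌋₊ *
      ∏ l ∈ Finset.univ.erase i, ⌊((B l).hi - (B l).lo) * 2 ^ K / 2⌋₊ := fun A => by
    unfold weight
    rw [← Finset.mul_prod_erase _ _ (Finset.mem_univ i)]
    congr 1
    · simp
    · refine Finset.prod_congr rfl fun l hl => ?_
      rw [Function.update_of_ne (Finset.ne_of_mem_erase hl)]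
  have h0 := h (B i)
  rw [Function.update_eq_self] at h0
  have hp : 2 ^ (K - j) = 2 ^ (K - (j + 1)) + 2 ^ (K - (j + 1)) := by
    rw [← two_mul, ← pow_succ']
    congr 1
    have := hI.1
    omega
  rw [h, h, h0, hI.floor_eq, hJ.floor_eq, hB.floor_eq, hp]
  ring

/-- An upper bound for the number of iterations that are still to come: a box of weight `w` is
the root of a binary tree with at most `w` leaves, hence with at most `2 w - 1` nodes. -/
def potential (K : ℕ) (s : Multiset (Box n)) : ℕ := (s.map fun B => 2 * weight K B - 1).sum

/-- The pending boxes arise from `[-1, 1] ^ n` by bisections, and the time that has passed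
together with the time that may still be needed is at most `A`. -/
def LoopInvariant (K T A : ℕ) (s : State n) : Prop :=
  (∀ B ∈ s.pending, ∀ i, ∃ j, Side K j (B i)) ∧ s.time + (T + 1) * potential K s.pending ≤ A

variable {K T A r : ℕ} {ρ : ℚ} {V : Matrix (Fin n) (Fin n) ℚ} {F : Fin n → Terms n}
  {J : Fin n → Fin n → Terms n}

theorem LoopInvariant.step
    (hT : ∀ B : Box n, (∀ i, ∃ j, Side K j (B i)) →
      Within (processBox M r ρ V F J B) T (SplitsInto K B))
    {s s' : State n} (hs : LoopInvariant K T A s) (h : Step M r ρ V F J s s') :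
    LoopInvariant K T A s' ∧ potential K s'.pending < potential K s.pending := by
  obtain ⟨B, BS, hp, rfl⟩ := h
  obtain ⟨hside, htime⟩ := hs
  rw [hp] at hside htime ⊢
  have hB := hside B (Multiset.mem_cons_self _ _)
  have hBS : ∀ P ∈ BS, ∀ i, ∃ j, Side K j (P i) :=
    fun P hP => hside P (Multiset.mem_cons_of_mem hP)
  have hpot : potential K (B ::ₘ BS) = (2 * weight K B - 1) + potential K BS := by
    simp [potential]
  have hw := weight_pos hB
  obtain ⟨hsplit, ht⟩ := hT B hB
  -- one unit of potential pays for one iteration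
  have key : ∀ p : ℕ, p + 1 ≤ potential K (B ::ₘ BS) →
      s.time + (processBox M r ρ V F J B).time + 1 + (T + 1) * p ≤ A := fun p hp' => by
    have := Nat.mul_le_mul_left (T + 1) hp'
    rw [mul_add] at this
    omega
  unfold State.update
  split
  · exact ⟨⟨hBS, key _ (by simp only; omega)⟩, by simp only; omega⟩
  · exact ⟨⟨hBS, key _ (by simp only; omega)⟩, by simp only; omega⟩
  · exact ⟨⟨hBS, key _ (by simp only; omega)⟩, by simp only; omega⟩
  · rename_i B₁ B₂ ho
    choose j hj using hB
    obtain ⟨i, I, I', rfl, rfl, hI, hI'⟩ := hsplit B₁ B₂ ho j hj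
    have hB1 := forall_update (i := i) (P := fun I => ∃ j, Side K j I) (fun l => ⟨j l, hj l⟩)
      ⟨_, hI⟩
    have hB2 := forall_update (i := i) (P := fun I => ∃ j, Side K j I) (fun l => ⟨j l, hj l⟩)
      ⟨_, hI'⟩
    have hsum := weight_split (hj i) hI hI'
    have w1 := weight_pos hB1
    have w2 := weight_pos hB2
    have hpot' : potential K (Function.update B i I ::ₘ Function.update B i I' ::ₘ BS) + 1 =
        potential K (B ::ₘ BS) := by
      rw [hpot]
      simp only [potential, Multiset.map_cons, Multiset.sum_cons]
      omega
    refine ⟨⟨?_, key _ hpot'.le⟩, by simp only; omega⟩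
    intro P hP
    rcases Multiset.mem_cons.1 hP with rfl | hP
    · exact hB1
    · rcases Multiset.mem_cons.1 hP with rfl | hP
      · exact hB2
      · exact hBS P hP

theorem LoopInvariant.reach (hT : ∀ B : Box n, (∀ i, ∃ j, Side K j (B i)) →
      Within (processBox M r ρ V F (jacobian M F).val B) T (SplitsInto K B))
    {s s' : State n} (hs : LoopInvariant K T A s) (h : Reach M r ρ V F s s') :
    LoopInvariant K T A s' := by
  induction h with
  | refl => exact hs
  | tail _ h ih => exact (ih.step hT h).1

theorem LoopInvariant.terminates (hT : ∀ B : Box n, (∀ i, ∃ j, Side K j (B i)) →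
      Within (processBox M r ρ V F (jacobian M F).val B) T (SplitsInto K B))
    {s : State n} (hs : LoopInvariant K T A s) :
    ∃ s' : State n, Reach M r ρ V F s s' ∧ s'.pending = 0 := by
  induction hN : potential K s.pending using Nat.strong_induction_on generalizing s with
  | _ N ih =>
  by_cases h0 : s.pending = 0
  · exact ⟨s, Relation.ReflTransGen.refl, h0⟩
  · obtain ⟨B, hB⟩ := Multiset.exists_mem_of_ne_zero h0
    obtain ⟨BS, hBS⟩ := Multiset.exists_cons_of_mem hB
    have hstep : Step M r ρ V F (jacobian M F).val s
        (s.update BS B (processBox M r ρ V F (jacobian M F).val B)) := ⟨B, BS, hBS, rfl⟩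
    obtain ⟨h1, h2⟩ := hs.step hT hstep
    obtain ⟨s', hs', hp⟩ := ih _ (hN ▸ h2) h1 rfl
    exact ⟨s', Relation.ReflTransGen.head hstep hs', hp⟩

theorem LoopInvariant.init (K T : ℕ) (F : Fin n → Terms n) :
    LoopInvariant K T ((jacobian M F).time + (T + 1) * (2 * 2 ^ (K * n))) (State.init M F) := by
  have hside : Side K 0 ⟨-1, 1⟩ :=
    ⟨Nat.zero_le _, ⟨(Rep.one (by positivity) one_pos).neg, Rep.one (by positivity) one_pos⟩,
      by norm_num⟩
  refine ⟨fun B hB i => ?_, ?_⟩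
  · obtain rfl := Multiset.mem_singleton.1 hB
    exact ⟨0, hside⟩
  · have hw : weight K (fun _ : Fin n => (⟨-1, 1⟩ : IV)) = 2 ^ (K * n) := by
      unfold weight
      rw [Finset.prod_congr rfl fun i _ => hside.floor_eq]
      simp [pow_mul]
    have hp : potential K (State.init M F).pending ≤ 2 * 2 ^ (K * n) := by
      simp only [potential, State.init, Multiset.map_singleton, Multiset.sum_singleton, hw]
      omega
    exact Nat.add_le_add_left (Nat.mul_le_mul_left _ hp) _

end Loop

/-! ### The size of the input -/

section Input

variable {n : ℕ}

theorem card_support_le {p : MvPolynomial (Fin n) ℤ} {d : ℕ} (h : p.totalDegree ≤ d) :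
    p.support.card ≤ (d + 1) ^ n := by
  have := Finset.card_le_card_of_injOn (s := p.support)
    (t := Fintype.piFinset fun _ : Fin n => Finset.range (d + 1)) (fun e => ⇑e)
    (fun e he => by
      refine Finset.mem_coe.2 (Fintype.mem_piFinset.2 fun i => Finset.mem_range.2 ?_)
      have h1 : e.degree ≤ d := by
        rw [Finsupp.degree_eq_sum]
        have := (MvPolynomial.le_totalDegree (Finset.mem_coe.1 he)).trans h
        rwa [Finsupp.sum_fintype _ _ fun _ => rfl] at this
      exact Nat.lt_succ_of_le ((Finsupp.le_degree i e).trans h1))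
    (fun _ _ _ _ h => DFunLike.coe_injective h)
  simpa [Fintype.card_piFinset] using this

theorem termsBound_termsOf {p : MvPolynomial (Fin n) ℤ} {d τ : ℕ} (h : p.totalDegree ≤ d)
    (hτ : ∀ e, Nat.size (p.coeff e).natAbs ≤ τ) : TermsBound d (2 ^ τ) (termsOf p) := by
  intro t ht
  obtain ⟨e, he, rfl⟩ := List.mem_map.1 ht
  have he := (Finset.mem_toList.1 he)
  constructor
  · have := (MvPolynomial.le_totalDegree he).trans h
    rwa [Finsupp.sum_fintype _ _ fun _ => rfl] at this
  · refine ⟨⟨p.coeff e, by simp⟩, ?_⟩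
    have h1 := (Nat.size_le.1 (hτ e)).le
    rw [← Int.cast_abs, ← Nat.cast_natAbs]
    exact_mod_cast h1

theorem length_termsOf (p : MvPolynomial (Fin n) ℤ) : (termsOf p).length = p.support.card := by
  simp [termsOf]

/-- The entries of a matrix of small rational numbers have a small common denominator. -/
theorem exists_common_denominator {V : Matrix (Fin n) (Fin n) ℚ} {c : ℕ}
    (h : ∀ i j, bitSize (V i j) ≤ c) :
    ∃ Q, 0 < Q ∧ Q ≤ 2 ^ (c * (n * n)) ∧ ∀ i j, Rep Q (2 ^ c) (V i j) := by
  have hden : ∀ i j, (V i j).den ≤ 2 ^ c := fun i j => by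
    refine (Nat.size_le.1 ?_).le
    have := h i j
    unfold bitSize at this
    omega
  have hQ : 0 < ∏ i, ∏ j, (V i j).den :=
    Finset.prod_pos fun i _ => Finset.prod_pos fun j _ => (V i j).den_pos
  refine ⟨∏ i, ∏ j, (V i j).den, hQ, ?_, fun i j => ?_⟩
  · calc ∏ i, ∏ j, (V i j).den ≤ ∏ _i : Fin n, ∏ _j : Fin n, 2 ^ c :=
          Finset.prod_le_prod' fun i _ => Finset.prod_le_prod' fun j _ => hden i j
      _ = _ := by simp [← pow_mul, mul_assoc]
  · have h1 : Rep (V i j).den (2 ^ c) (V i j) := by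
      refine ⟨⟨(V i j).num, (Rat.num_div_den _).symm⟩, ?_⟩
      have h2 : (V i j).num.natAbs ≤ 2 ^ c := by
        refine (Nat.size_le.1 ?_).le
        have := h i j
        unfold bitSize at this
        omega
      have h3 : |V i j| ≤ (V i j).num.natAbs := by
        rw [Nat.cast_natAbs, Int.cast_abs]
        nth_rewrite 1 [← Rat.num_div_den (V i j)]
        rw [abs_div, Nat.abs_cast]
        exact div_le_self (abs_nonneg _) (by exact_mod_cast (V i j).den_pos)
      exact h3.trans (by exact_mod_cast h2)
    exact h1.mono hQ ((Finset.dvd_prod_of_mem (fun j => (V i j).den) (Finset.mem_univ j)).trans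
      (Finset.dvd_prod_of_mem (fun i => ∏ j, (V i j).den) (Finset.mem_univ i))) le_rfl

/-- The size of all numbers is at most a polynomial in `n` times the size of the values of the
polynomials: determinants and common denominators of matrices cost a factor `n` each. -/
theorem exists_budget (β K : ℕ) {d τ Q : ℕ} (hn : 0 < n) (hd : 0 < d) (hQ : 0 < Q)
    (hQ' : Q ≤ 2 ^ (β * n * (n * n))) :
    ∃ b : Budget n, b.K = K ∧ b.d = d ∧ b.C = 2 ^ τ * d ∧ b.N = (d + 1) ^ n ∧ b.Q = Q ∧
      b.H₀ = 2 ^ (β * n) ∧ b.S = (2 * β + 21) * (n ^ 4 * ((K + 1) * d + τ)) := by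
  set Y := (K + 1) * d + τ with hY
  have hY1 : 0 < Y := by positivity
  have hYd : τ + d ≤ Y := by
    have : d ≤ (K + 1) * d := Nat.le_mul_of_pos_left _ (by omega)
    omega
  obtain ⟨Z, hZ⟩ : ∃ Z, Z = n ^ 3 * Y := ⟨_, rfl⟩
  have z2 : n ^ 2 * Y ≤ Z := by
    rw [hZ]
    exact Nat.mul_le_mul_right _ (Nat.pow_le_pow_right hn (by norm_num))
  have z1 : n * Y ≤ n ^ 2 * Y := Nat.mul_le_mul_right _ (Nat.le_self_pow (by norm_num) _)
  have z0 : n ≤ n * Y := Nat.le_mul_of_pos_right _ hY1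
  have zY : Y ≤ n * Y := Nat.le_mul_of_pos_left _ hn
  have n2 : n ≤ 2 ^ n := Nat.lt_two_pow_self.le
  have pw : ∀ {a b : ℕ}, a ≤ b → 2 ^ a ≤ 2 ^ b := fun h => Nat.pow_le_pow_right two_pos h
  have mulp : ∀ {x y a b : ℕ}, x ≤ 2 ^ a → y ≤ 2 ^ b → x * y ≤ 2 ^ (a + b) :=
    fun hx hy => by rw [pow_add]; exact Nat.mul_le_mul hx hy
  have powp : ∀ {x a : ℕ}, x ≤ 2 ^ a → x ^ n ≤ 2 ^ (n * a) :=
    fun hx => by rw [mul_comm, pow_mul]; exact Nat.pow_le_pow_left hx n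
  -- exponents of `2` are estimated by linear combinations of `Y`, `n * Y`, `n ^ 2 * Y`, `Z`, `β * Z`
  obtain ⟨D₁, hD₁⟩ : ∃ D₁, D₁ = 2 ^ ((K + 1) * d) := ⟨_, rfl⟩
  obtain ⟨H₁, hH₁⟩ : ∃ H₁, H₁ = (d + 1) ^ n * (2 ^ τ * d) := ⟨_, rfl⟩
  obtain ⟨D₂, hD₂⟩ : ∃ D₂, D₂ = D₁ ^ n := ⟨_, rfl⟩
  obtain ⟨H₂, hH₂⟩ : ∃ H₂, H₂ = (n * H₁) ^ n := ⟨_, rfl⟩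
  obtain ⟨D₃, hD₃⟩ : ∃ D₃, D₃ = D₂ * ((D₂ * H₂) * (D₂ * H₂)) := ⟨_, rfl⟩
  obtain ⟨H₃, hH₃⟩ : ∃ H₃, H₃ = 2 * H₂ * D₂ := ⟨_, rfl⟩
  obtain ⟨D₄, hD₄⟩ : ∃ D₄, D₄ = Q * D₃ := ⟨_, rfl⟩
  obtain ⟨H₄, hH₄⟩ : ∃ H₄, H₄ = n * (2 ^ (β * n) * H₃) := ⟨_, rfl⟩
  obtain ⟨D₅, hD₅⟩ : ∃ D₅, D₅ = D₄ * D₁ := ⟨_, rfl⟩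
  obtain ⟨H₅, hH₅⟩ : ∃ H₅, H₅ = n * (H₄ * H₁) := ⟨_, rfl⟩
  have d1 : D₁ ≤ 2 ^ Y := by rw [hD₁]; exact pw (by omega)
  have h1 : H₁ ≤ 2 ^ (2 * (n * Y)) := by
    have e1 : (d + 1) ^ n ≤ 2 ^ (n * d) := powp Nat.lt_two_pow_self
    have e2 : 2 ^ τ * d ≤ 2 ^ (τ + d) := mulp le_rfl Nat.lt_two_pow_self.le
    have e3 : n * d ≤ n * Y := Nat.mul_le_mul_left _ (by omega)
    rw [hH₁]
    exact (mulp e1 e2).trans (pw (by omega))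
  have nh1 : n * H₁ ≤ 2 ^ (3 * (n * Y)) := (mulp n2 h1).trans (pw (by omega))
  have d2 : D₂ ≤ 2 ^ (n ^ 2 * Y) := by rw [hD₂]; exact (powp d1).trans (pw z1)
  have h2 : H₂ ≤ 2 ^ (3 * (n ^ 2 * Y)) := by
    rw [hH₂]; exact (powp nh1).trans (pw (le_of_eq (by ring)))
  have d3 : D₃ ≤ 2 ^ (9 * (n ^ 2 * Y)) := by
    rw [hD₃]; exact (mulp d2 (mulp (mulp d2 h2) (mulp d2 h2))).trans (pw (by omega))
  have h3 : H₃ ≤ 2 ^ (5 * (n ^ 2 * Y)) := by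
    rw [hH₃]; exact (mulp (mulp (a := 1) (by norm_num) h2) d2).trans (pw (by omega))
  have bn : β * n ≤ β * Z := Nat.mul_le_mul_left _ (by omega)
  have d4 : D₄ ≤ 2 ^ (β * Z + 9 * Z) := by
    rw [hD₄]
    refine (mulp hQ' d3).trans (pw (Nat.add_le_add ?_ (by omega)))
    rw [mul_assoc]
    refine Nat.mul_le_mul_left _ ?_
    rw [hZ]
    calc n * (n * n) = n ^ 3 * 1 := by ring
      _ ≤ _ := Nat.mul_le_mul_left _ hY1
  have h4 : H₄ ≤ 2 ^ (β * Z + 6 * Z) := by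
    rw [hH₄]; exact (mulp n2 (mulp le_rfl h3)).trans (pw (by omega))
  have d5 : D₅ ≤ 2 ^ (β * Z + 10 * Z) := by
    rw [hD₅]; exact (mulp d4 d1).trans (pw (by omega))
  have h5 : n * H₅ ≤ 2 ^ (β * Z + 10 * Z) := by
    rw [hH₅]; exact (mulp n2 (mulp n2 (mulp h4 h1))).trans (pw (by omega))
  have d5pos : 0 < D₅ := by
    have : 0 < H₁ := by rw [hH₁]; positivity
    have : 0 < D₁ := by rw [hD₁]; positivity
    have : 0 < H₂ := by rw [hH₂]; positivity
    have : 0 < D₂ := by rw [hD₂]; positivity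
    have : 0 < D₃ := by rw [hD₃]; positivity
    have : 0 < D₄ := by rw [hD₄]; positivity
    rw [hD₅]
    positivity
  have hS : 2 * (n * (β * Z + 10 * Z)) < (2 * β + 21) * (n ^ 4 * Y) := by
    have : 0 < n ^ 4 * Y := by positivity
    calc 2 * (n * (β * Z + 10 * Z)) = (2 * β + 20) * (n ^ 4 * Y) := by rw [hZ]; ring
      _ < _ := by rw [add_mul, add_mul]; omega
  refine ⟨⟨(2 * β + 21) * (n ^ 4 * Y), K, d, 2 ^ τ * d, (d + 1) ^ n, Q, 2 ^ (β * n),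
    D₁, H₁, D₂, H₂, D₃, H₃, D₄, H₄, D₅, H₅, hn, hd, by positivity, by positivity, hQ,
    by positivity, hD₁, hH₁, hD₂, hH₂, hD₃, hH₃, hD₄, hH₄, hD₅, hH₅, ⟨by positivity, ?_, ?_⟩, ?_⟩,
    rfl, rfl, rfl, rfl, rfl, rfl, rfl⟩
  · exact (powp d5).trans_lt (Nat.pow_lt_pow_right (by norm_num) (by omega))
  · exact (mulp (powp d5) (powp h5)).trans_lt (Nat.pow_lt_pow_right (by norm_num) (by omega))
  · have : Y ≤ n ^ 4 * Y := Nat.le_mul_of_pos_left _ (by positivity)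
    calc 2 * ((K + 1) * d) ≤ 2 * Y := by omega
      _ ≤ (2 * β + 21) * (n ^ 4 * Y) := Nat.mul_le_mul (by omega) this

end Input

/-! ### The total cost -/

/-- `n!` is exponentially smaller than `n ^ n`, because `(1 + 1 / n) ^ n ≥ 2`. -/
theorem two_pow_mul_factorial_le (n : ℕ) : 2 ^ n * n.factorial ≤ 2 * n ^ n := by
  induction n with
  | zero => simp
  | succ n ih =>
    rcases Nat.eq_zero_or_pos n with rfl | hn
    · simp
    have h : 2 * n ^ n ≤ (n + 1) ^ n := by
      have h1 := one_add_mul_le_pow (a := (1 : ℝ) / n) (by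
        have : (0 : ℝ) ≤ 1 / n := by positivity
        linarith) n
      have hn' : (0 : ℝ) < n := by exact_mod_cast hn
      have h2 : (1 : ℝ) + n * (1 / n) = 2 := by field_simp; norm_num
      rw [h2, one_add_div hn'.ne', div_pow, le_div_iff₀ (by positivity)] at h1
      exact_mod_cast h1
    calc 2 ^ (n + 1) * (n + 1).factorial = 2 * (n + 1) * (2 ^ n * n.factorial) := by
          rw [Nat.factorial_succ]; ring
      _ ≤ 2 * (n + 1) * (2 * n ^ n) := Nat.mul_le_mul_left _ ih
      _ ≤ 2 * (n + 1) * (n + 1) ^ n := Nat.mul_le_mul_left _ h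
      _ = _ := by ring

/-- Polynomial factors are absorbed by the quotient of `n ^ n` and `n !`. -/
theorem exists_pow_mul_factorial_le (a s : ℕ) :
    ∃ c : ℝ, 0 < c ∧ ∀ n : ℕ, 0 < n → (n : ℝ) ^ a * ((n + s).factorial : ℝ) ≤ c * (n : ℝ) ^ n := by
  obtain ⟨c₀, hc₀⟩ := (tendsto_pow_const_div_const_pow_of_one_lt (a + s)
    (r := (2 : ℝ)) (by norm_num)).bddAbove_range
  have hc₀ : ∀ n : ℕ, (n : ℝ) ^ (a + s) ≤ max c₀ 1 * 2 ^ n := fun n => by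
    have := hc₀ ⟨n, rfl⟩
    rw [div_le_iff₀ (by positivity)] at this
    exact this.trans (mul_le_mul_of_nonneg_right (le_max_left _ _) (by positivity))
  have hpos : (0 : ℝ) < max c₀ 1 := lt_max_of_lt_right one_pos
  refine ⟨2 * (1 + s) ^ s * max c₀ 1, by positivity, fun n hn => ?_⟩
  have h1 : (n + s).factorial ≤ n.factorial * (n * (1 + s)) ^ s := by
    rw [← Nat.factorial_mul_ascFactorial]
    refine Nat.mul_le_mul_left _ ((Nat.ascFactorial_le_pow_add _ _).trans ?_)
    refine Nat.pow_le_pow_left ?_ _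
    have : s ≤ n * s := Nat.le_mul_of_pos_left _ hn
    rw [mul_add]
    omega
  have h1' : ((n + s).factorial : ℝ) ≤ n.factorial * (n * (1 + s)) ^ s := by exact_mod_cast h1
  have h2 : (2 : ℝ) ^ n * n.factorial ≤ 2 * n ^ n := by exact_mod_cast two_pow_mul_factorial_le n
  calc (n : ℝ) ^ a * ((n + s).factorial : ℝ)
      ≤ n ^ a * (n.factorial * (n * (1 + s)) ^ s) := by gcongr
    _ = (1 + s) ^ s * n.factorial * n ^ (a + s) := by rw [mul_pow, pow_add]; ring
    _ ≤ (1 + s) ^ s * n.factorial * (max c₀ 1 * 2 ^ n) := by gcongr; exact hc₀ n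
    _ = (1 + s) ^ s * max c₀ 1 * (2 ^ n * n.factorial) := by ring
    _ ≤ (1 + s) ^ s * max c₀ 1 * (2 * n ^ n) := by gcongr
    _ = _ := by ring

/-- The number of bisections of a side, for a given precision. -/
theorem exists_depth {ρ : ℚ} (h0 : 0 < ρ) (h1 : ρ < 1) :
    ∃ K : ℕ, 2 / 2 ^ K ≤ ρ ∧ (2 : ℝ) ^ K ≤ 4 / (ρ : ℝ) := by
  have hex : ∃ K : ℕ, 2 / ρ ≤ 2 ^ K := by
    obtain ⟨K, hK⟩ := pow_unbounded_of_one_lt (2 / ρ) (by norm_num : (1 : ℚ) < 2)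
    exact ⟨K, hK.le⟩
  classical
  have hs := Nat.find_spec hex
  set K := Nat.find hex with hK
  refine ⟨K, ?_, ?_⟩
  · rw [div_le_iff₀ h0] at hs
    rw [div_le_iff₀ (by positivity), mul_comm]
    exact hs
  · have hK0 : K ≠ 0 := by
      intro h
      rw [h, pow_zero, div_le_iff₀ h0] at hs
      linarith
    have hmin := Nat.find_min hex (m := K - 1) (by omega)
    have h2 : (2 : ℚ) ^ K ≤ 4 / ρ := by
      rw [not_le] at hmin
      have h3 : (2 : ℚ) ^ K = 2 ^ (K - 1) * 2 := by
        rw [← pow_succ, Nat.sub_add_cancel (by omega)]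
      rw [h3, show (4 : ℚ) / ρ = 2 / ρ * 2 by ring]
      linarith
    exact_mod_cast h2

/-- For precisions bounded away from `1`, the size of a value of a polynomial at a vertex of a
box is bounded by the argument of `M` in the complexity bound. -/
theorem exists_size_le {ρ₀ : ℝ} (hρ₀ : ρ₀ < 1) :
    ∃ c : ℕ, ∀ (ρ : ℚ) (K d τ : ℕ), 0 < ρ → (ρ : ℝ) ≤ ρ₀ → (2 : ℝ) ^ K ≤ 4 / (ρ : ℝ) →
      (K + 1) * d + τ ≤ c * ⌈-(d : ℝ) * Real.logb 2 ρ + τ⌉₊ := by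
  -- `q` replaces `ρ₀`, which may be negative, where `Real.logb` has no meaning
  set q := max ρ₀ (1 / 2) with hq
  have hq0 : 0 < q := lt_max_of_lt_right (by norm_num)
  have hq1 : q < 1 := max_lt hρ₀ (by norm_num)
  set L := -Real.logb 2 q with hL
  have hL0 : 0 < L := neg_pos.2 (Real.logb_neg (by norm_num) hq0 hq1)
  obtain ⟨c, hc⟩ := exists_nat_ge (1 + 3 / L)
  refine ⟨c, fun ρ K d τ h0 hρ hK => ?_⟩
  have h0' : (0 : ℝ) < ρ := by exact_mod_cast h0
  set l := -Real.logb 2 ρ with hl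
  have hLl : L ≤ l := neg_le_neg (Real.logb_le_logb_of_le (by norm_num) h0'
    (hρ.trans (le_max_left _ _)))
  have hKl : (K : ℝ) ≤ 2 + l := by
    have := Real.logb_le_logb_of_le (b := 2) (by norm_num) (by positivity) hK
    rw [Real.logb_div (by norm_num) h0'.ne', ← Real.rpow_natCast, Real.logb_rpow (by norm_num)
      (by norm_num), show (4 : ℝ) = 2 ^ (2 : ℝ) by norm_num, Real.logb_rpow (by norm_num)
      (by norm_num)] at this
    linarith
  have h3 : l + 3 ≤ c * l := by
    have : 3 ≤ 3 / L * l := by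
      rw [div_mul_eq_mul_div, le_div_iff₀ hL0]
      linarith
    have := mul_le_mul_of_nonneg_right hc (hL0.le.trans hLl)
    linarith
  have hc1 : (1 : ℝ) ≤ c := by
    have : 0 < 3 / L := by positivity
    linarith
  have h4 : (((K + 1) * d + τ : ℕ) : ℝ) ≤ c * (-(d : ℝ) * Real.logb 2 ρ + τ) := by
    push_cast
    have e1 : ((K : ℝ) + 1) * d ≤ (c * l) * d := by gcongr; linarith
    have e2 : (τ : ℝ) ≤ c * τ := le_mul_of_one_le_left (by positivity) hc1
    calc ((K : ℝ) + 1) * d + τ ≤ (c * l) * d + c * τ := add_le_add e1 e2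
      _ = _ := by rw [hl]; ring
  have h5 := mul_le_mul_of_nonneg_left (Nat.le_ceil (-(d : ℝ) * Real.logb 2 ρ + τ))
    (Nat.cast_nonneg (α := ℝ) c)
  exact_mod_cast h4.trans h5

theorem jacobian_time_le {M : ℕ → ℕ} (hM : IsArithCost M) {n : ℕ} {S d C m : ℕ} (hd : 0 < d)
    (hC : 0 < C) (hf : Fits S 1 (C * d)) {F : Fin n → Terms n} (hF : ∀ i, TermsBound d C (F i))
    (hm : ∀ i, (F i).length ≤ m) : (jacobian M F).time ≤ n * (n * (m * M (4 * S))) := by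
  have := Within.tabulate (f := fun i => tabulate fun j => diffPoly M j (F i))
    (P := fun _ _ => True) fun i => Within.imp (Within.tabulate fun j =>
      (diffPoly_within hM hd hC hf j (hF i)).le (Nat.mul_le_mul_right _ (hm i)))
        fun _ _ => trivial
  exact this.2

end RootIsolation

theorem theorem3p13 (r β : ℕ) (ρ₀ : ℝ) (hρ₀ : ρ₀ < 1) :
    ∃ C : ℝ, 0 < C ∧
      ∀ (n d τ m : ℕ) (ρ : ℚ) (M : ℕ → ℕ) (V : Matrix (Fin n) (Fin n) ℚ)
        (F : Fin n → MvPolynomial (Fin n) ℤ),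
        1 ≤ n → 1 ≤ d → 1 ≤ τ → 1 ≤ m →
        0 < ρ → (ρ : ℝ) ≤ ρ₀ →
        IsArithCost M →
        IsSM V → (∀ i j, bitSize (V i j) ≤ β * n) →
        (∀ i, (F i).totalDegree ≤ d) →
        (∀ i e, Nat.size ((F i).coeff e).natAbs ≤ τ) →
        (∀ i, (F i).support.card ≤ m) →
        ∀ s : State n, Reach M r ρ V (fun i => termsOf (F i))
            (State.init M fun i => termsOf (F i)) s →
          (∃ s' : State n, Reach M r ρ V (fun i => termsOf (F i)) s s' ∧ s'.pending = 0) ∧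
          (s.time : ℝ) ≤ C * (8 / (ρ : ℝ)) ^ n * (n : ℝ) ^ (n + 1) * m *
            M ⌈-(d : ℝ) * Real.logb 2 ρ + τ⌉₊ := by
  obtain ⟨c₁, hc₁⟩ := exists_size_le hρ₀
  obtain ⟨c₂, hc₂0, hc₂⟩ := exists_pow_mul_factorial_le 11 (2 * r)
  set c₃ : ℝ := (((4 * (2 * β + 21) * c₁) ^ 2 : ℕ) : ℝ) with hc₃
  refine ⟨1650 * (r + 1) * c₃ * c₂ + 1, by positivity, ?_⟩
  intro n d τ m ρ M V F hn hd hτ hm hρ hρ' hM _ hV hdeg hcoeff hsupp s hs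
  have hρ1 : ρ < 1 := by exact_mod_cast hρ'.trans_lt hρ₀
  have hρR : (0 : ℝ) < ρ := by exact_mod_cast hρ
  obtain ⟨K, hK, hK4⟩ := exists_depth hρ hρ1
  obtain ⟨Q, hQ0, hQ, hVQ⟩ := exists_common_denominator hV
  obtain ⟨b, rfl, rfl, hbC, hbN, rfl, hbH, hbS⟩ := exists_budget (τ := τ) β K hn hd hQ0 hQ
  rw [← hbH] at hVQ
  set P : Fin n → Terms n := fun i => termsOf (F i) with hP
  have hlen : ∀ i, (P i).length ≤ m := fun i => (length_termsOf (F i)).trans_le (hsupp i)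
  have hlenN : ∀ i, (P i).length ≤ b.N := fun i => by
    rw [hbN]; exact (length_termsOf (F i)).trans_le (card_support_le (hdeg i))
  have hterms : ∀ i, TermsBound b.d (2 ^ τ) (P i) := fun i =>
    termsBound_termsOf (hdeg i) (hcoeff i)
  have hPb : ∀ i, PolyBound b m (P i) := fun i => by
    refine ⟨fun t ht => ⟨(hterms i t ht).1, (hterms i t ht).2.mono_right ?_⟩, hlenN i, hlen i⟩
    rw [hbC]
    exact Nat.le_mul_of_pos_right _ hd
  have hfC : Fits b.S 1 (2 ^ τ * b.d) := by
    have h := b.fits₁.mono_right (H' := b.C) (by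
      rw [b.H₁_eq]; exact Nat.le_mul_of_pos_left _ b.N_pos)
    rw [hbC] at h
    exact h.mono one_pos h.1 le_rfl
  have hJb : ∀ i j, PolyBound b m ((jacobian M P).val i j) := fun i j => by
    have h := (diffPoly_within hM hd (by positivity) hfC j (hterms i)).1
    refine ⟨?_, h.2.trans (hlenN i), h.2.trans (hlen i)⟩
    rw [hbC]
    exact h.1
  have hjac := jacobian_time_le hM hd (by positivity) hfC hterms hlen
  have hbox := fun (B : Box n) (hB : ∀ i, ∃ j, Side b.K j (B i)) =>
    processBox_within (b := b) hM r hρ hK hm hVQ hPb hJb hB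
  set U := M (4 * b.S) with hU
  set N := (n + 2 * r).factorial with hN
  set T := 330 * ((r + 1) * (2 ^ n * (n ^ 3 * (N * (m * U))))) with hT
  have hinv := (LoopInvariant.init (M := M) b.K T P).reach hbox hs
  refine ⟨hinv.terminates hbox, ?_⟩
  have hN1 : 0 < N := Nat.factorial_pos _
  have hU1 : 0 < U := by
    refine lt_of_lt_of_le ?_ (hM.le_self _)
    rw [hbS]
    have := b.d_pos
    positivity
  have hT1 : 1 ≤ T := Nat.succ_le_of_lt (by positivity)
  have hjT : (jacobian M P).time ≤ T := by
    refine hjac.trans ?_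
    have h1 : 1 ≤ 330 * ((r + 1) * (2 ^ n * (n * N))) := Nat.succ_le_of_lt (by positivity)
    calc n * (n * (m * U)) = 1 * (n ^ 2 * (m * U)) := by ring
      _ ≤ 330 * ((r + 1) * (2 ^ n * (n * N))) * (n ^ 2 * (m * U)) := Nat.mul_le_mul_right _ h1
      _ = T := by rw [hT]; ring
  have htime : s.time ≤ 5 * T * 2 ^ (b.K * n) := by
    have h1 : 1 ≤ 2 ^ (b.K * n) := Nat.one_le_two_pow
    calc s.time ≤ (jacobian M P).time + (T + 1) * (2 * 2 ^ (b.K * n)) :=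
          (Nat.le_add_right _ _).trans hinv.2
      _ ≤ T * 2 ^ (b.K * n) + (T + T) * (2 * 2 ^ (b.K * n)) :=
          Nat.add_le_add (hjT.trans (Nat.le_mul_of_pos_right _ h1))
            (Nat.mul_le_mul_right _ (by omega))
      _ = _ := by ring
  set X := ⌈-(b.d : ℝ) * Real.logb 2 ρ + τ⌉₊ with hX
  have hUX : (U : ℝ) ≤ c₃ * (n : ℝ) ^ 8 * M X := by
    have h1 : 4 * b.S ≤ 4 * (2 * β + 21) * c₁ * n ^ 4 * X := by
      rw [hbS]
      calc 4 * ((2 * β + 21) * (n ^ 4 * ((b.K + 1) * b.d + τ)))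
          ≤ 4 * ((2 * β + 21) * (n ^ 4 * (c₁ * X))) := by
            gcongr
            exact hc₁ ρ b.K b.d τ hρ hρ' hK4
        _ = _ := by ring
    have h2 := (hM.mono h1).trans (hM.mul_le _ _)
    calc (U : ℝ) ≤ (((4 * (2 * β + 21) * c₁ * n ^ 4) ^ 2 * M X : ℕ) : ℝ) := by exact_mod_cast h2
      _ = _ := by rw [hc₃]; push_cast; ring
  have hpow : ((2 ^ (b.K * n) : ℕ) : ℝ) ≤ (4 / (ρ : ℝ)) ^ n := by
    push_cast
    rw [pow_mul]
    exact pow_le_pow_left₀ (by positivity) hK4 n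
  have hfac : (n : ℝ) ^ 11 * (N : ℝ) ≤ c₂ * (n : ℝ) ^ (n + 1) := by
    refine (hc₂ n hn).trans (mul_le_mul_of_nonneg_left ?_ hc₂0.le)
    exact pow_le_pow_right₀ (by exact_mod_cast hn) (Nat.le_succ n)
  calc (s.time : ℝ) ≤ ((5 * T * 2 ^ (b.K * n) : ℕ) : ℝ) := by exact_mod_cast htime
    _ = 1650 * (r + 1) * (2 ^ n * ((2 ^ (b.K * n) : ℕ) : ℝ)) * n ^ 3 * N * m * U := by
        rw [hT]; push_cast; ring
    _ ≤ 1650 * (r + 1) * (2 ^ n * (4 / (ρ : ℝ)) ^ n) * n ^ 3 * N * m * (c₃ * n ^ 8 * M X) := by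
        gcongr
    _ = 1650 * (r + 1) * c₃ * (8 / (ρ : ℝ)) ^ n * (n ^ 11 * N) * m * M X := by
        rw [← mul_pow, show 2 * (4 / (ρ : ℝ)) = 8 / ρ by ring]; ring
    _ ≤ 1650 * (r + 1) * c₃ * (8 / (ρ : ℝ)) ^ n * (c₂ * (n : ℝ) ^ (n + 1)) * m * M X := by
        gcongr
    _ = (1650 * (r + 1) * c₃ * c₂) * (8 / (ρ : ℝ)) ^ n * (n : ℝ) ^ (n + 1) * m * M X := by ring
    _ ≤ _ := by
        gcongr
        linarith
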